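/- Let $M$ be a smooth 4-dimensional manifold with a smooth coframe field $\vartheta^a$, $a=0,1,2,3$, declared to be orthonormal, i.e. $M$ carries the Lorentzian metric $g=\eta_{ab}\,\vartheta^a\otimes\vartheta^b$, $\eta=\mathrm{diag}(1,-1,-1,-1)$. Indices are raised and lowered with $\eta$, repeated indices are summed over, $e_a$ is the dual frame, $\vartheta_a=\eta_{am}\vartheta^m$ and $\vartheta^{a_1\dots a_p}=\vartheta^{a_1}\wedge\dots\wedge\vartheta^{a_p}$. Let $*:\Omega^p\to\Omega^{4-p}$ be the Hodge dual, that is, the $C^\infty(M)$-linear map with $$*\vartheta^{a_1\dots a_p}=\frac1{(4-p)!}\,\epsilon^{a_1\dots a_p b_1\dots b_{4-p}}\,\vartheta_{b_1}\wedge\dots\wedge\vartheta_{b_{4-p}},$$ where $\epsilon^{abcd}$ is completely antisymmetric with $\epsilon^{0123}=1$, and let $d^\dagger=-*d*:\Omega^p\to\Omega^{p-1}$ for $1\le p\le 4$. The objects of anholonomity ${C^a}_{bc}=-{C^a}_{cb}$ are defined by $d\vartheta^a=\frac12{C^a}_{bc}\vartheta^{bc}$, i.e. ${C^a}_{bc}=d\vartheta^a(e_b,e_c)$,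 and $C_a={C^m}_{am}$. Then for $2\le p\le 4$ and all indices $a_1,\dots,a_p\in\{0,1,2,3\}$ $$(p-1)\,d^\dagger(\vartheta^{a_1\dots a_p})=\sum_{i=1}^p(-1)^i\,\vartheta^{a_i}\wedge d^\dagger(\vartheta^{a_1\dots\hat a_i\dots a_p})+(-1)^p\,\vartheta^m\wedge *(d\vartheta_m\wedge *\vartheta^{a_1\dots a_p}),$$ and, for all indices $a,b,c,d\in\{0,1,2,3\}$, $$d^\dagger\vartheta^a=C^a,$$ $$d^\dagger\vartheta^{ab}=C^a\vartheta^b-C^b\vartheta^a-{C_m}^{ab}\vartheta^m,$$ $$d^\dagger\vartheta^{abc}=C^a\vartheta^{bc}-C^b\vartheta^{ac}+C^c\vartheta^{ab}+{C_m}^{bc}\vartheta^{am}-{C_m}^{ac}\vartheta^{bm}+{C_m}^{ab}\vartheta^{cm},$$ $$d^\dagger\vartheta^{abcd}=0.$$ -/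

import Mathlib

open Module
open scoped Manifold ContDiff

noncomputable section

namespace CoframeGeometry

/-! ### Exterior algebra of a real topological vector space -/

section Linear

variable {V : Type*} [AddCommGroup V] [Module ℝ V] [TopologicalSpace V]

/-- The continuous multilinear map `v ↦ α (v₀, …, v_{m-1}) * β (v_m, …, v_{m+n-1})`. -/
def tensorMul {m n r : ℕ} (h : m + n = r) (α : V [⋀^Fin m]→L[ℝ] ℝ) (β : V [⋀^Fin n]→L[ℝ] ℝ) :
    ContinuousMultilinearMap ℝ (fun _ : Fin r => V) ℝ where
  toMultilinearMap :=
    ((LinearMap.mul' ℝ ℝ).compMultilinearMap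
      (MultilinearMap.domCoprod α.toMultilinearMap β.toMultilinearMap)).domDomCongr
        (finSumFinEquiv.trans (finCongr h))
  cont := by
    have h1 : Continuous fun v : Fin r → V =>
        α (fun i => v (Fin.cast h (Fin.castAdd n i))) *
          β (fun j => v (Fin.cast h (Fin.natAdd m j))) :=
      (α.cont.comp (continuous_pi fun i => continuous_apply _)).mul
        (β.cont.comp (continuous_pi fun i => continuous_apply _))
    exact h1

theorem tensorMul_apply {m n r : ℕ} (h : m + n = r) (α : V [⋀^Fin m]→L[ℝ] ℝ)
    (β : V [⋀^Fin n]→L[ℝ] ℝ) (v : Fin r → V) :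
    tensorMul h α β v =
      α (fun i => v (Fin.cast h (Fin.castAdd n i))) *
        β (fun j => v (Fin.cast h (Fin.natAdd m j))) := rfl

/-- The exterior product of an `m`-form and an `n`-form,
`(α ∧ β)(v) = 1/(m! n!) ∑_σ sign(σ) α(v_{σ 0}, …) β(v_{σ m}, …)`, so that for two 1-forms
`(α ∧ β)(u, v) = α(u) β(v) - α(v) β(u)`. The target degree `r` is given with a proof of
`m + n = r`. -/
def wedge {m n r : ℕ} (h : m + n = r) (α : V [⋀^Fin m]→L[ℝ] ℝ) (β : V [⋀^Fin n]→L[ℝ] ℝ) :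
    V [⋀^Fin r]→L[ℝ] ℝ :=
  ((m.factorial : ℝ) * (n.factorial : ℝ))⁻¹ •
    ContinuousMultilinearMap.alternatization (tensorMul h α β)

/-- A covector as a 1-form. -/
def oneForm (θ : V →L[ℝ] ℝ) : V [⋀^Fin 1]→L[ℝ] ℝ :=
  ContinuousAlternatingMap.ofSubsingleton ℝ V ℝ (0 : Fin 1) θ

/-- A scalar as a 0-form. -/
def zeroForm (c : ℝ) : V [⋀^Fin 0]→L[ℝ] ℝ :=
  ContinuousAlternatingMap.constOfIsEmpty ℝ V (Fin 0) c

/-- The iterated exterior product `θ₀ ∧ θ₁ ∧ … ∧ θ_{p-1}` of 1-forms (`1` if `p = 0`). -/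
def wedgeProd : (p : ℕ) → (Fin p → (V →L[ℝ] ℝ)) → V [⋀^Fin p]→L[ℝ] ℝ
  | 0, _ => zeroForm 1
  | p + 1, θ => wedge (Nat.add_comm 1 p) (oneForm (θ 0)) (wedgeProd p (fun i => θ i.succ))

/-- The Minkowski matrix `η = diag(1, -1, -1, -1)` (it is its own inverse). -/
def eta (a b : Fin 4) : ℝ := if a = b then (if a = 0 then 1 else -1) else 0

/-- The completely antisymmetric symbol `ε^{abcd}` with `ε^{0123} = 1`. -/
def epsilon (f : Fin 4 → Fin 4) : ℝ :=
  ((Matrix.of fun i j : Fin 4 => if f i = j then (1 : ℤ) else 0).det : ℤ)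

/-- The coframe with lowered index, `ϑ_a = η_{am} ϑ^m`. -/
def lowerCoframe (θ : Fin 4 → (V →L[ℝ] ℝ)) (a : Fin 4) : V →L[ℝ] ℝ := ∑ m, eta a m • θ m

theorem exists_dualFrame (hV : finrank ℝ V = 4) (θ : Fin 4 → (V →L[ℝ] ℝ))
    (hθ : LinearIndependent ℝ θ) :
    ∃ e : Fin 4 → V, ∀ a b, θ a (e b) = if a = b then 1 else 0 := by
  classical
  have : FiniteDimensional ℝ V := FiniteDimensional.of_finrank_pos (by omega)
  have hθ' : LinearIndependent ℝ (fun a => (θ a : Dual ℝ V)) :=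
    hθ.map' (ContinuousLinearMap.coeLM (R := ℝ) ℝ (M := V) (N₃ := ℝ))
      (LinearMap.ker_eq_bot.2 ContinuousLinearMap.coe_injective)
  let B : Basis (Fin 4) ℝ (Dual ℝ V) :=
    basisOfLinearIndependentOfCardEqFinrank hθ' (by simp [Subspace.dual_finrank_eq, hV])
  refine ⟨fun b => (evalEquiv ℝ V).symm (B.coord b), fun a b => ?_⟩
  have h1 : (θ a : Dual ℝ V) ((evalEquiv ℝ V).symm (B.coord b)) = B.coord b (θ a) := by
    simp
  have h2 : (θ a : Dual ℝ V) = B a := by simp [B]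
  have h3 : θ a ((evalEquiv ℝ V).symm (B.coord b)) = B.coord b (B a) := by rw [← h2]; exact h1
  rw [h3]
  simp [Finsupp.single_apply]

/-- The Hodge dual `Λ^p → Λ^q`, `p + q = 4`, determined by a coframe `θ` with dual frame `e` that
is declared orthonormal, i.e. by the metric `g = η_{ab} θ^a ⊗ θ^b` and the orientation for which
`ε^{0123} = 1`. It is the linear map with
`*(θ^{a₁} ∧ … ∧ θ^{a_p}) = (1/q!) ε^{a₁ … a_p b₁ … b_q} θ_{b₁} ∧ … ∧ θ_{b_q}`,
applied to `ω = (1/p!) ω(e_{a₁}, …, e_{a_p}) θ^{a₁} ∧ … ∧ θ^{a_p}`. -/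
def hodge (θ : Fin 4 → (V →L[ℝ] ℝ)) (e : Fin 4 → V) {p q : ℕ} (h : p + q = 4)
    (α : V [⋀^Fin p]→L[ℝ] ℝ) : V [⋀^Fin q]→L[ℝ] ℝ :=
  ((p.factorial : ℝ) * (q.factorial : ℝ))⁻¹ •
    ∑ a : Fin p → Fin 4, ∑ b : Fin q → Fin 4,
      (α (fun i => e (a i)) * epsilon (fun i => Fin.append a b (Fin.cast h.symm i))) •
        wedgeProd q (fun j => lowerCoframe θ (b j))

end Linear

/-! ### Differential forms on a 4-manifold -/

section Manifold

variable {M : Type*} [TopologicalSpace M] [ChartedSpace (EuclideanSpace ℝ (Fin 4)) M]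

variable (M) in
/-- Differential `p`-forms on `M` (arbitrary sections; no regularity is built in). -/
abbrev DForm (p : ℕ) : Type _ :=
  (x : M) → (TangentSpace (𝓡 4) x) [⋀^Fin p]→L[ℝ] ℝ

/-- The coordinate expression of a form in the preferred chart `φ` at `x₀`: the pull-back of `ω`
along `φ⁻¹`, a form on the model space (relevant on the open set `φ.target` only). -/
def inChart {p : ℕ} (α : DForm M p) (x₀ : M) :
    EuclideanSpace ℝ (Fin 4) → (EuclideanSpace ℝ (Fin 4)) [⋀^Fin p]→L[ℝ] ℝ :=
  fun y => (α ((extChartAt (𝓡 4) x₀).symm y)).compContinuousLinearMap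
    (mfderiv (𝓡 4) (𝓡 4) (extChartAt (𝓡 4) x₀).symm y)

/-- The exterior derivative `d : Ω^p → Ω^{p+1}`, computed at each point `x` in the preferred chart
`φ` at `x`: `(dω)_x = φ^* (d ((φ⁻¹)^* ω))`. -/
def extD {p : ℕ} (α : DForm M p) : DForm M (p + 1) :=
  fun x => (extDeriv (inChart α x) (extChartAt (𝓡 4) x x)).compContinuousLinearMap
    (mfderiv (𝓡 4) (𝓡 4) (extChartAt (𝓡 4) x) x)

variable [IsManifold (𝓡 4) ∞ M]

variable (M) in
/-- A smooth coframe field `{ϑ^a, a = 0, 1, 2, 3}`: four smooth sections of the cotangent bundle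
that are linearly independent at every point. It is declared orthonormal, i.e. `M` carries the
metric `g = η_{ab} ϑ^a ⊗ ϑ^b`. -/
structure Coframe where
  toFun : Fin 4 → (x : M) → (TangentSpace (𝓡 4) x →L[ℝ] ℝ)
  smooth : ∀ a, ContMDiff (𝓡 4) ((𝓡 4).prod 𝓘(ℝ, EuclideanSpace ℝ (Fin 4) →L[ℝ] ℝ)) ∞
    (fun x => Bundle.TotalSpace.mk' (EuclideanSpace ℝ (Fin 4) →L[ℝ] ℝ)
      (E := fun x : M => TangentSpace (𝓡 4) x →L[ℝ] Bundle.Trivial M ℝ x) x (toFun a x))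
  linearIndependent : ∀ x, LinearIndependent ℝ (fun a => toFun a x)

namespace Coframe

variable (ϑ : Coframe M)

/-- The dual frame `e_b`, with `ϑ^a(e_b) = δ^a_b`. -/
def frame (x : M) : Fin 4 → TangentSpace (𝓡 4) x :=
  Classical.choose (exists_dualFrame (V := TangentSpace (𝓡 4) x)
    (finrank_euclideanSpace_fin (𝕜 := ℝ) (n := 4)) (fun a => ϑ.toFun a x) (ϑ.linearIndependent x))

theorem apply_frame (x : M) (a b : Fin 4) :
    ϑ.toFun a x (ϑ.frame x b) = if a = b then 1 else 0 :=
  Classical.choose_spec (exists_dualFrame (V := TangentSpace (𝓡 4) x)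
    (finrank_euclideanSpace_fin (𝕜 := ℝ) (n := 4)) (fun a => ϑ.toFun a x)
    (ϑ.linearIndependent x)) a b

/-- The basis `p`-form `ϑ^{a₁ … a_p} = ϑ^{a₁} ∧ … ∧ ϑ^{a_p}`. -/
def basis {p : ℕ} (a : Fin p → Fin 4) : DForm M p :=
  fun x => wedgeProd p (fun i => ϑ.toFun (a i) x)

/-- The 1-form `ϑ^a`. -/
def up (a : Fin 4) : DForm M 1 := fun x => oneForm (ϑ.toFun a x)

/-- The 1-form with lowered index `ϑ_a = η_{am} ϑ^m`. -/
def down (a : Fin 4) : DForm M 1 := fun x => oneForm (lowerCoframe (fun b => ϑ.toFun b x) a)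

/-- The Hodge dual `* : Ω^p → Ω^q`, `p + q = 4`, of the metric `g = η_{ab} ϑ^a ⊗ ϑ^b`. -/
def star {p q : ℕ} (h : p + q = 4) (α : DForm M p) : DForm M q :=
  fun x => hodge (fun a => ϑ.toFun a x) (ϑ.frame x) h (α x)

/-- The coderivative `d† = - * d * : Ω^{p+1} → Ω^p`, for `p + 1 ≤ 4`. -/
def codiff {p : ℕ} (h : p + 1 ≤ 4) (α : DForm M (p + 1)) : DForm M p :=
  -ϑ.star (p := 3 - p + 1) (q := p) (by omega)
    (extD (ϑ.star (p := p + 1) (q := 3 - p) (by omega) α))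

/-- The objects of anholonomity `C^a_{bc} = e_c ⌟ (e_b ⌟ dϑ^a) = dϑ^a(e_b, e_c)`, i.e. the
coefficients, antisymmetric in `b, c`, of `dϑ^a = ½ C^a_{bc} ϑ^{bc}`. -/
def anhol (a b c : Fin 4) (x : M) : ℝ := extD (ϑ.up a) x ![ϑ.frame x b, ϑ.frame x c]

/-- The contraction `C_a = C^m_{am}`. -/
def anholTrace (a : Fin 4) (x : M) : ℝ := ∑ m, ϑ.anhol m a m x

/-- `C^a = η^{ab} C_b`. -/
def anholTraceUp (a : Fin 4) (x : M) : ℝ := ∑ b, eta a b * ϑ.anholTrace b x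

/-- `C_m^{ab} = η_{mn} η^{ar} η^{bs} C^n_{rs}`. -/
def anholMixed (m a b : Fin 4) (x : M) : ℝ :=
  ∑ n, ∑ r, ∑ s, eta m n * eta a r * eta b s * ϑ.anhol n r s x

end Coframe

/-- The pointwise exterior product of differential forms. -/
def fwedge {m n r : ℕ} (h : m + n = r) (α : DForm M m) (β : DForm M n) : DForm M r :=
  fun x => wedge h (α x) (β x)

/-- The product of a function and a form. -/
def fsmul {p : ℕ} (f : M → ℝ) (α : DForm M p) : DForm M p := fun x => f x • α x

/-- A function as a 0-form. -/
def ofFun (f : M → ℝ) : DForm M 0 := fun x => zeroForm (f x)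

end Manifold

end CoframeGeometry

end

open CoframeGeometry

noncomputable section

namespace CoframeGeometry

/-! ### Antisymmetric symbols, exterior products and the Hodge dual in a dual frame -/

section Linear
variable {V : Type*} [AddCommGroup V] [Module ℝ V] [TopologicalSpace V]

/-! The identities are checked pointwise on the dual frame, computing in the preferred chart at the
point. In the chart, `*ϑ^{a₁…a_n}` is `∑_b ε^{ab} ∏ ϑ_{b_l}`, the factorials cancelling against
antisymmetry. By the Leibniz rule the only derivatives that enter are the numbers `jet m r s =
(∂_{e_r} ϑ_m)(e_s)`, and `star_extD_star_basis_apply` gives each component of `*d*` as a combination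
of jets whose coefficients are contracted products of two `ε` symbols.

The contraction identities (`epsInt_contract_two`, `epsInt_contract_one`, `epsInt_contract_zero`)
rewrite these coefficients through `η^{ra}η^{sb} - η^{rb}η^{sa}`. Only the antisymmetric part of the
jet in `r, s` survives, and that part is `C_m^{ab}` (`sum_etaInt₂_mul_jet`). This yields the closed
formulas for `d†`; in degree 4 the dual is a constant function, so `d` kills it.

The term `*(dϑ_m ∧ *ϑ^{a…})` is evaluated by the same contractions. For `p = 2, 3` the recursion is
then linear algebra in the basis forms. For `p = 4` the left side is zero and the right side is
three times a trace of the antisymmetrization of `C_m ⊗ ϑ^{cde}` in five indices, which vanishes in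
dimension four (`antisymmSum_eq_zero`). -/

theorem wedge_apply {m n r : ℕ} (h : m + n = r) (α : V [⋀^Fin m]→L[ℝ] ℝ)
    (β : V [⋀^Fin n]→L[ℝ] ℝ) (v : Fin r → V) :
    wedge h α β v = ((m.factorial : ℝ) * (n.factorial : ℝ))⁻¹ *
      ∑ σ : Equiv.Perm (Fin r), ((Equiv.Perm.sign σ : ℤ) : ℝ) * tensorMul h α β (v ∘ σ) := by
  simp only [wedge, ContinuousAlternatingMap.smul_apply, smul_eq_mul]
  congr 1
  rw [ContinuousMultilinearMap.alternatization_apply_apply]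
  refine Finset.sum_congr rfl fun σ _ => ?_
  rw [Units.smul_def, zsmul_eq_mul]

/-- Determinant expansion, by induction on `p`. Every permutation `τ` of the last `p` slots can be
absorbed into the outer permutation, so the `p!` inner terms contribute equally and cancel the
normalisation of `wedge`. -/
theorem wedgeProd_apply (p : ℕ) (θ : Fin p → (V →L[ℝ] ℝ)) (v : Fin p → V) :
    wedgeProd p θ v =
      ∑ σ : Equiv.Perm (Fin p), ((Equiv.Perm.sign σ : ℤ) : ℝ) * ∏ i, θ i (v (σ i)) := by
  induction p with
  | zero => simp [wedgeProd, zeroForm]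
  | succ p ih =>
    have hfac : (p.factorial : ℝ) ≠ 0 := by positivity
    rw [wedgeProd, wedge_apply, Nat.factorial_one, Nat.cast_one, one_mul,
      inv_mul_eq_iff_eq_mul₀ hfac]
    have hc : ((Fintype.card (Equiv.Perm (Fin p)) : ℕ) : ℝ) = p.factorial := by
      rw [Fintype.card_perm, Fintype.card_fin]
    have key : ∀ σ : Equiv.Perm (Fin (p + 1)),
        tensorMul (Nat.add_comm 1 p) (oneForm (θ 0)) (wedgeProd p fun i => θ i.succ) (v ∘ σ) =
          ∑ τ : Equiv.Perm (Fin p), ((Equiv.Perm.sign τ : ℤ) : ℝ) *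
            ∏ i, θ i (v (σ (Equiv.Perm.decomposeFin.symm (0, τ) i))) := by
      intro σ
      rw [tensorMul_apply, ih, Finset.mul_sum]
      refine Finset.sum_congr rfl fun τ _ => ?_
      rw [Fin.prod_univ_succ, mul_left_comm]
      have h0 : (Fin.cast (Nat.add_comm 1 p) (Fin.castAdd p (0 : Fin 1))) = 0 := rfl
      have h1 : ∀ j : Fin p, (Fin.cast (Nat.add_comm 1 p) (Fin.natAdd 1 j)) = j.succ := by
        intro j; ext; simp
      simp [oneForm, h0, h1]
    simp_rw [key]
    rw [← hc]
    simp_rw [Finset.mul_sum (ι := Equiv.Perm (Fin p))]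
    rw [Finset.sum_comm, ← nsmul_eq_mul, ← Finset.card_univ, ← Finset.sum_const]
    refine Finset.sum_congr rfl fun τ _ => ?_
    -- `τ` is extended by fixing `0`, which preserves its sign, and removed by right translation.
    refine Fintype.sum_equiv (Equiv.mulRight (Equiv.Perm.decomposeFin.symm (0, τ))) _ _ fun σ => ?_
    rw [← mul_assoc]
    simp [Equiv.Perm.sign_mul]

theorem wedgeProd_apply' (p : ℕ) (θ : Fin p → (V →L[ℝ] ℝ)) (v : Fin p → V) :
    wedgeProd p θ v =
      ∑ σ : Equiv.Perm (Fin p), ((Equiv.Perm.sign σ : ℤ) : ℝ) * ∏ i, θ (σ i) (v i) := by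
  rw [wedgeProd_apply]
  refine Fintype.sum_equiv (Equiv.inv _) _ _ fun σ => ?_
  simp only [Equiv.inv_apply, Equiv.Perm.sign_inv]
  congr 1
  exact Fintype.prod_equiv σ _ _ fun i => by simp

/-- A function of `p` indices that is completely antisymmetric. -/
def IsAntisymm {p : ℕ} (G : (Fin p → Fin 4) → ℝ) : Prop :=
  ∀ (a : Fin p → Fin 4) (σ : Equiv.Perm (Fin p)), G (a ∘ σ) = ((Equiv.Perm.sign σ : ℤ) : ℝ) * G a

theorem sign_mul_self_cast {p : ℕ} (σ : Equiv.Perm (Fin p)) :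
    ((Equiv.Perm.sign σ : ℤ) : ℝ) * ((Equiv.Perm.sign σ : ℤ) : ℝ) = 1 := by
  rw [← Int.cast_mul, ← Units.val_mul, Int.units_mul_self]; simp

theorem isAntisymm_apply {p : ℕ} (α : V [⋀^Fin p]→L[ℝ] ℝ) (e : Fin 4 → V) :
    IsAntisymm fun a => α (fun i => e (a i)) := by
  intro a σ
  have := α.toAlternatingMap.map_perm (fun i => e (a i)) σ
  rw [Units.smul_def, zsmul_eq_mul] at this
  exact this

/-- Contraction of an antisymmetric symbol with a signed sum over permutations. -/
theorem IsAntisymm.sum_mul_sum_perm {p : ℕ} {G : (Fin p → Fin 4) → ℝ} (hG : IsAntisymm G)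
    (F : (Fin p → Fin 4) → ℝ) :
    ∑ a, G a * ∑ σ : Equiv.Perm (Fin p), ((Equiv.Perm.sign σ : ℤ) : ℝ) * F (a ∘ σ) =
      p.factorial * ∑ a, G a * F a := by
  have hc : ((Fintype.card (Equiv.Perm (Fin p)) : ℕ) : ℝ) = p.factorial := by
    rw [Fintype.card_perm, Fintype.card_fin]
  simp_rw [Finset.mul_sum]
  rw [Finset.sum_comm, ← Finset.mul_sum, ← hc, ← nsmul_eq_mul, ← Finset.card_univ,
    ← Finset.sum_const]
  refine Finset.sum_congr rfl fun σ _ => ?_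
  refine Fintype.sum_equiv (σ.symm.arrowCongr (Equiv.refl _)) _ _ fun a => ?_
  have : (σ.symm.arrowCongr (Equiv.refl _)) a = a ∘ σ := by ext; simp
  rw [this, hG a σ]
  ring

/-- An antisymmetric symbol already alternates, so the alternation inside `wedge` only contributes
the factor `r!`. -/
theorem IsAntisymm.sum_mul_wedge {m n r : ℕ} (h : m + n = r) {G : (Fin r → Fin 4) → ℝ}
    (hG : IsAntisymm G) (α : V [⋀^Fin m]→L[ℝ] ℝ) (β : V [⋀^Fin n]→L[ℝ] ℝ) (e : Fin 4 → V) :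
    ∑ a, G a * wedge h α β (fun i => e (a i)) =
      ((m.factorial : ℝ) * (n.factorial : ℝ))⁻¹ * (r.factorial *
        ∑ a, G a * tensorMul h α β (fun i => e (a i))) := by
  rw [← hG.sum_mul_sum_perm, Finset.mul_sum]
  refine Finset.sum_congr rfl fun a _ => ?_
  rw [wedge_apply, mul_left_comm]
  rfl

theorem IsAntisymm.sum_mul_wedgeProd {p : ℕ} {G : (Fin p → Fin 4) → ℝ} (hG : IsAntisymm G)
    (θ : Fin p → (V →L[ℝ] ℝ)) (e : Fin 4 → V) :
    ∑ a, G a * wedgeProd p θ (fun i => e (a i)) =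
      p.factorial * ∑ a, G a * ∏ i, θ i (e (a i)) := by
  rw [← hG.sum_mul_sum_perm]
  simp_rw [wedgeProd_apply]
  rfl

theorem IsAntisymm.sum_mul_wedgeProd' {p : ℕ} {G : (Fin p → Fin 4) → ℝ} (hG : IsAntisymm G)
    (θ : Fin 4 → (V →L[ℝ] ℝ)) (v : Fin p → V) :
    ∑ b, G b * wedgeProd p (fun i => θ (b i)) v = p.factorial * ∑ b, G b * ∏ i, θ (b i) (v i) := by
  rw [← hG.sum_mul_sum_perm]
  simp_rw [wedgeProd_apply']
  rfl

theorem sum_eq_sum_insertNth {p : ℕ} (k : Fin (p + 1)) (f : (Fin (p + 1) → Fin 4) → ℝ) :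
    ∑ a, f a = ∑ r : Fin 4, ∑ a : Fin p → Fin 4, f (k.insertNth (α := fun _ => Fin 4) r a) := by
  rw [← (Fin.insertNthEquiv (fun _ => Fin 4) k).sum_comp, Fintype.sum_prod_type]
  rfl

/-- Moving an entry from position `k` to the front is a cycle of sign `(-1)^k`. -/
theorem IsAntisymm.insertNth {p : ℕ} {G : (Fin (p + 1) → Fin 4) → ℝ} (hG : IsAntisymm G)
    (k : Fin (p + 1)) (r : Fin 4) (a : Fin p → Fin 4) :
    G (k.insertNth (α := fun _ => Fin 4) r a) =
      (-1) ^ (k : ℕ) * G (Fin.cons (α := fun _ => Fin 4) r a) := by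
  rw [← Fin.cons_comp_cycleRange r a k, hG, Fin.sign_cycleRange]
  simp

theorem IsAntisymm.cons {p : ℕ} {G : (Fin (p + 1) → Fin 4) → ℝ} (hG : IsAntisymm G) (r : Fin 4) :
    IsAntisymm fun a : Fin p → Fin 4 => G (Fin.cons (α := fun _ => Fin 4) r a) := by
  intro a σ
  have := hG (Fin.cons (α := fun _ => Fin 4) r a) (Equiv.Perm.decomposeFin.symm (0, σ))
  rw [Equiv.Perm.decomposeFin.symm_sign, if_pos rfl, one_mul] at this
  rw [← this]
  refine congrArg G (funext fun i => ?_)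
  refine Fin.cases ?_ (fun i => ?_) i <;> simp

theorem eta_of_ne {a b : Fin 4} (h : a ≠ b) : eta a b = 0 := if_neg h

/-- The product `η_{j₁j₁} … η_{j_qj_q}`. -/
def etaProd {q : ℕ} (j : Fin q → Fin 4) : ℝ := ∏ l, eta (j l) (j l)

theorem sum_mul_prod_eta {q : ℕ} (G : (Fin q → Fin 4) → ℝ) (j : Fin q → Fin 4) :
    ∑ b, G b * ∏ l, eta (b l) (j l) = G j * etaProd j := by
  rw [Fintype.sum_eq_single j]
  · rfl
  · intro b hb
    obtain ⟨l, hl⟩ := Function.ne_iff.1 hb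
    rw [Finset.prod_eq_zero (Finset.mem_univ l) (eta_of_ne hl), mul_zero]

/-- Contraction of two antisymmetric symbols with the sum, over the position `k`, of a product in
which the `k`-th factor is exceptional. -/
theorem IsAntisymm.sum_mul_sum_update {p : ℕ} {G H : (Fin (p + 1) → Fin 4) → ℝ}
    (hG : IsAntisymm G) (hH : IsAntisymm H) (Y : Fin 4 → Fin 4 → ℝ) :
    ∑ b, ∑ i, H b * (G i * ∑ k, (∏ l ∈ Finset.univ.erase k, eta (b l) (i l)) * Y (b k) (i k)) =
      (p + 1) * ∑ m : Fin 4, ∑ s : Fin 4, ∑ i : Fin p → Fin 4,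
        H (Fin.cons m i) * G (Fin.cons s i) * etaProd i * Y m s := by
  -- The summand does not depend on `k`: bringing the exceptional index to the front costs `(-1)^k`
  -- in `G` and again in `H`, and the remaining factors `η` identify the other indices.
  have key : ∀ k : Fin (p + 1), ∑ b, ∑ i, H b * (G i *
      ((∏ l ∈ Finset.univ.erase k, eta (b l) (i l)) * Y (b k) (i k))) =
      ∑ m : Fin 4, ∑ s : Fin 4, ∑ i : Fin p → Fin 4,
        H (Fin.cons m i) * G (Fin.cons s i) * etaProd i * Y m s := by
    intro k
    rw [sum_eq_sum_insertNth k]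
    refine Finset.sum_congr rfl fun m _ => ?_
    have : ∀ b : Fin p → Fin 4, ∑ i : Fin (p + 1) → Fin 4,
        H (k.insertNth (α := fun _ => Fin 4) m b) * (G i * ((∏ l ∈ Finset.univ.erase k,
          eta (k.insertNth (α := fun _ => Fin 4) m b l) (i l)) * Y m (i k))) =
        ∑ s : Fin 4, ∑ i : Fin p → Fin 4, (H (Fin.cons m b) * G (Fin.cons s i) * Y m s) *
          ∏ l, eta (b l) (i l) := by
      intro b
      rw [sum_eq_sum_insertNth k]
      refine Finset.sum_congr rfl fun s _ => Finset.sum_congr rfl fun i _ => ?_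
      have h1 : ∏ l ∈ Finset.univ.erase k, eta (k.insertNth (α := fun _ => Fin 4) m b l)
          (k.insertNth (α := fun _ => Fin 4) s i l) = ∏ l, eta (b l) (i l) := by
        have : Finset.univ.erase k = Finset.univ.map (Fin.succAboveEmb k) := by
          ext l
          simp [Fin.exists_succAbove_eq_iff]
        rw [this, Finset.prod_map]
        simp
      have h2 : ((-1 : ℝ) ^ (k : ℕ)) * (-1) ^ (k : ℕ) = 1 := by rw [← mul_pow]; simp
      simp only [h1, hG.insertNth, hH.insertNth,
        Fin.insertNth_apply_same]
      linear_combination (H (Fin.cons m b) * G (Fin.cons s i) * Y m s * ∏ l, eta (b l) (i l)) * h2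
    simp only [Fin.insertNth_apply_same]
    rw [Finset.sum_congr rfl fun b _ => this b, Finset.sum_comm]
    refine Finset.sum_congr rfl fun s _ => ?_
    rw [Finset.sum_comm]
    refine Finset.sum_congr rfl fun i _ => ?_
    rw [sum_mul_prod_eta (fun b => H (Fin.cons m b) * G (Fin.cons s i) * Y m s)]
    ring
  simp_rw [Finset.mul_sum (ι := Fin (p + 1))]
  rw [Finset.sum_congr rfl fun b _ => Finset.sum_comm, Finset.sum_comm,
    Finset.sum_congr rfl fun k _ => key k]
  simp

/-- The signs `(-1)^k` in the alternation cancel those produced by `G`, leaving `p + 1` equal terms.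
-/
theorem IsAntisymm.sum_mul_alternatizeUncurryFin {E : Type*} [NormedAddCommGroup E]
    [NormedSpace ℝ E] {p : ℕ} {G : (Fin (p + 1) → Fin 4) → ℝ}
    (hG : IsAntisymm G) (f : E →L[ℝ] E [⋀^Fin p]→L[ℝ] ℝ) (e : Fin 4 → E) :
    ∑ a, G a * ContinuousAlternatingMap.alternatizeUncurryFin f (fun i => e (a i)) =
      (p + 1) * ∑ r : Fin 4, ∑ a : Fin p → Fin 4,
        G (Fin.cons r a) * f (e r) (fun i => e (a i)) := by
  simp_rw [ContinuousAlternatingMap.alternatizeUncurryFin_apply, Finset.mul_sum]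
  rw [Finset.sum_comm]
  have : ∀ k : Fin (p + 1), ∑ a : Fin (p + 1) → Fin 4,
      G a * ((-1) ^ (k : ℕ) • f (e (a k)) (k.removeNth fun i => e (a i))) =
      ∑ r : Fin 4, ∑ a : Fin p → Fin 4, G (Fin.cons r a) * f (e r) (fun i => e (a i)) := by
    intro k
    rw [sum_eq_sum_insertNth k]
    refine Finset.sum_congr rfl fun r _ => Finset.sum_congr rfl fun a _ => ?_
    have h2 : (k.removeNth fun i => e (k.insertNth (α := fun _ => Fin 4) r a i)) =
        fun i => e (a i) := by
      funext i; simp [Fin.removeNth]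
    have : ((-1 : ℝ) ^ (k : ℕ)) * (-1) ^ (k : ℕ) = 1 := by rw [← mul_pow]; simp
    simp only [hG.insertNth, h2, Fin.insertNth_apply_same,
      zsmul_eq_mul, Int.cast_pow, Int.cast_neg, Int.cast_one]
    linear_combination (G (Fin.cons r a) * f (e r) (fun i => e (a i))) * this
  rw [Finset.sum_congr rfl fun k _ => this k]
  simp only [Finset.sum_const, Finset.card_univ, Fintype.card_fin, nsmul_eq_mul]
  push_cast
  simp_rw [Finset.mul_sum]

/-- The symbol `ε^{a₁ … a_p b₁ … b_q}`, `p + q = 4`. -/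
def eps {p q : ℕ} (h : p + q = 4) (a : Fin p → Fin 4) (b : Fin q → Fin 4) : ℝ :=
  epsilon (fun i => Fin.append a b (Fin.cast h.symm i))

theorem epsilon_comp_perm (f : Fin 4 → Fin 4) (σ : Equiv.Perm (Fin 4)) :
    epsilon (f ∘ σ) = ((Equiv.Perm.sign σ : ℤ) : ℝ) * epsilon f := by
  unfold epsilon
  have := Matrix.det_permute σ (Matrix.of fun i j : Fin 4 => if f i = j then (1 : ℤ) else 0)
  rw [← Int.cast_mul]
  exact congrArg _ this

/-- In this form a pair of permutations of the two blocks acts as `Equiv.Perm.sumCongr`, whose sign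
is the product of the two signs. -/
theorem eps_eq {p q : ℕ} (h : p + q = 4) (a : Fin p → Fin 4) (b : Fin q → Fin 4) :
    eps h a b = epsilon (Sum.elim a b ∘ (finSumFinEquiv.trans (finCongr h)).symm) := by
  unfold eps
  congr 1
  funext i
  obtain ⟨i, rfl⟩ := (finSumFinEquiv.trans (finCongr h)).surjective i
  rcases i with i | i <;> simp

theorem eps_comp_perm {p q : ℕ} (h : p + q = 4) (a : Fin p → Fin 4) (b : Fin q → Fin 4)
    (σ : Equiv.Perm (Fin p)) (τ : Equiv.Perm (Fin q)) :
    eps h (a ∘ σ) (b ∘ τ) =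
      ((Equiv.Perm.sign σ : ℤ) : ℝ) * ((Equiv.Perm.sign τ : ℤ) : ℝ) * eps h a b := by
  rw [eps_eq, eps_eq]
  have := epsilon_comp_perm (Sum.elim a b ∘ (finSumFinEquiv.trans (finCongr h)).symm)
    ((finSumFinEquiv.trans (finCongr h)).permCongr (Equiv.Perm.sumCongr σ τ))
  rw [Equiv.Perm.sign_permCongr, Equiv.Perm.sign_sumCongr] at this
  push_cast at this
  rw [← this]
  congr 1
  funext i
  obtain ⟨i, rfl⟩ := (finSumFinEquiv.trans (finCongr h)).surjective i
  rcases i with i | i <;> simp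

theorem isAntisymm_eps_left {p q : ℕ} (h : p + q = 4) (b : Fin q → Fin 4) :
    IsAntisymm fun a => eps h a b := by
  intro a σ
  simpa using eps_comp_perm h a b σ 1

theorem isAntisymm_eps_right {p q : ℕ} (h : p + q = 4) (a : Fin p → Fin 4) :
    IsAntisymm fun b => eps h a b := by
  intro b τ
  simpa using eps_comp_perm h a b 1 τ

/-- The pair `(θ, e)` consists of a coframe and its dual frame. -/
def IsDual (θ : Fin 4 → (V →L[ℝ] ℝ)) (e : Fin 4 → V) : Prop :=
  ∀ a b, θ a (e b) = if a = b then 1 else 0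

theorem IsDual.lowerCoframe_apply {θ : Fin 4 → (V →L[ℝ] ℝ)} {e : Fin 4 → V} (h : IsDual θ e)
    (a b : Fin 4) : lowerCoframe θ a (e b) = eta a b := by
  simp [lowerCoframe, h _ b]

theorem IsDual.sum_mul_prod {θ : Fin 4 → (V →L[ℝ] ℝ)} {e : Fin 4 → V} (h : IsDual θ e) {q : ℕ}
    (G : (Fin q → Fin 4) → ℝ) (j : Fin q → Fin 4) :
    ∑ b, G b * ∏ l, θ (b l) (e (j l)) = G j := by
  rw [Fintype.sum_eq_single j]
  · simp [h _ _]
  · intro b hb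
    obtain ⟨l, hl⟩ := Function.ne_iff.1 hb
    rw [Finset.prod_eq_zero (Finset.mem_univ l) (by rw [h, if_neg hl]), mul_zero]

theorem IsDual.sum_mul_prod' {θ : Fin 4 → (V →L[ℝ] ℝ)} {e : Fin 4 → V} (h : IsDual θ e) {q : ℕ}
    (G : (Fin q → Fin 4) → ℝ) (j : Fin q → Fin 4) :
    ∑ b, G b * ∏ l, θ (j l) (e (b l)) = G j := by
  rw [← h.sum_mul_prod G j]
  simp only [h _ _, eq_comm]

theorem hodge_eq (θ : Fin 4 → (V →L[ℝ] ℝ)) (e : Fin 4 → V) {p q : ℕ} (h : p + q = 4)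
    (α : V [⋀^Fin p]→L[ℝ] ℝ) : hodge θ e h α = ((p.factorial : ℝ) * (q.factorial : ℝ))⁻¹ •
      ∑ a : Fin p → Fin 4, ∑ b : Fin q → Fin 4, (α (fun i => e (a i)) * eps h a b) •
        wedgeProd q (fun j => lowerCoframe θ (b j)) := rfl

/-- The components of the Hodge dual with respect to the dual frame. -/
theorem IsDual.hodge_apply {θ : Fin 4 → (V →L[ℝ] ℝ)} {e : Fin 4 → V} (hd : IsDual θ e) {p q : ℕ}
    (h : p + q = 4) (α : V [⋀^Fin p]→L[ℝ] ℝ) (j : Fin q → Fin 4) :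
    hodge θ e h α (fun i => e (j i)) =
      (p.factorial : ℝ)⁻¹ * (∑ a, eps h a j * α (fun i => e (a i))) * etaProd j := by
  have hq : (q.factorial : ℝ) ≠ 0 := by positivity
  have : ∀ a : Fin p → Fin 4, (∑ b : Fin q → Fin 4, (α (fun i => e (a i)) * eps h a b) *
        wedgeProd q (fun l => lowerCoframe θ (b l)) (fun i => e (j i))) =
      α (fun i => e (a i)) * (q.factorial * (eps h a j * etaProd j)) := by
    intro a
    simp_rw [mul_assoc]
    rw [← Finset.mul_sum,
      (isAntisymm_eps_right h a).sum_mul_wedgeProd' (lowerCoframe θ) (fun i => e (j i))]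
    simp_rw [hd.lowerCoframe_apply]
    rw [sum_mul_prod_eta]
  simp only [hodge_eq, ContinuousAlternatingMap.smul_apply, ContinuousAlternatingMap.sum_apply,
    smul_eq_mul]
  rw [Finset.sum_congr rfl fun a _ => this a, mul_inv, Finset.mul_sum, Finset.mul_sum,
    Finset.sum_mul]
  refine Finset.sum_congr rfl fun a _ => ?_
  field_simp

theorem IsDual.wedgeProd_contract_eps {θ : Fin 4 → (V →L[ℝ] ℝ)} {e : Fin 4 → V} (hd : IsDual θ e)
    {p q : ℕ} (h : p + q = 4) (a : Fin p → Fin 4) (j : Fin q → Fin 4) :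
    (p.factorial : ℝ)⁻¹ * ∑ a', eps h a' j * wedgeProd p (fun i => θ (a i)) (fun i => e (a' i)) =
      eps h a j := by
  have hp : (p.factorial : ℝ) ≠ 0 := by positivity
  rw [(isAntisymm_eps_left h j).sum_mul_wedgeProd (fun i => θ (a i)) e,
    hd.sum_mul_prod' (fun b => eps h b j) a, inv_mul_cancel_left₀ hp]

theorem IsDual.hodge_wedgeProd {θ : Fin 4 → (V →L[ℝ] ℝ)} {e : Fin 4 → V} (hd : IsDual θ e)
    {p q : ℕ} (h : p + q = 4) (a : Fin p → Fin 4) :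
    hodge θ e h (wedgeProd p fun i => θ (a i)) =
      (q.factorial : ℝ)⁻¹ • ∑ b, eps h a b • wedgeProd q (fun j => lowerCoframe θ (b j)) := by
  rw [hodge_eq, Finset.sum_comm, mul_inv, mul_comm, mul_smul]
  congr 1
  rw [Finset.smul_sum]
  refine Finset.sum_congr rfl fun b _ => ?_
  rw [← hd.wedgeProd_contract_eps h a b, ← Finset.sum_smul, smul_smul]
  congr 2
  refine Finset.sum_congr rfl fun a' _ => mul_comm _ _

theorem IsDual.hodge_wedgeProd_apply {θ : Fin 4 → (V →L[ℝ] ℝ)} {e : Fin 4 → V} (hd : IsDual θ e)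
    {p q : ℕ} (h : p + q = 4) (a : Fin p → Fin 4) (j : Fin q → Fin 4) :
    hodge θ e h (wedgeProd p fun i => θ (a i)) (fun i => e (j i)) = eps h a j * etaProd j := by
  rw [hd.hodge_apply, hd.wedgeProd_contract_eps]

/-- The components of `*(F ∧ *θ^{a₁ … a_n})` for a 2-form `F`. -/
theorem IsDual.hodge_wedge_hodge_apply {θ : Fin 4 → (V →L[ℝ] ℝ)} {e : Fin 4 → V}
    (hd : IsDual θ e) {n q r p : ℕ} (h : n + q = 4) (h1 : 2 + q = r) (h2 : r + p = 4)
    (F : V [⋀^Fin 2]→L[ℝ] ℝ) (a : Fin n → Fin 4) (j : Fin p → Fin 4) :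
    hodge θ e h2 (wedge h1 F (hodge θ e h (wedgeProd n fun i => θ (a i)))) (fun i => e (j i)) =
      (2 * (q.factorial : ℝ))⁻¹ * (∑ c : Fin 2 → Fin 4, ∑ i : Fin q → Fin 4,
        eps h2 (fun l => Fin.append c i (Fin.cast h1.symm l)) j * eps h a i * etaProd i *
          F (fun l => e (c l))) * etaProd j := by
  subst h1
  have hr : ((2 + q).factorial : ℝ) ≠ 0 := by positivity
  -- The `(2 + q)!` of the wedge cancels that of the Hodge dual; the index tuple is then split into
  -- the two slots of `F` and the `q` slots of the dual.
  rw [hd.hodge_apply, (isAntisymm_eps_left h2 j).sum_mul_wedge, mul_left_comm,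
    inv_mul_cancel_left₀ hr, ← (Fin.appendEquiv 2 q).sum_comp, Fintype.sum_prod_type]
  simp only [Nat.factorial_two, Nat.cast_ofNat]
  congr 2
  refine Finset.sum_congr rfl fun c _ => Finset.sum_congr rfl fun i _ => ?_
  rw [tensorMul_apply]
  simp only [Fin.appendEquiv, Equiv.coe_fn_mk, Fin.cast_eq_self, Fin.append_left, Fin.append_right,
    hd.hodge_wedgeProd_apply]
  ring

theorem IsDual.linearIndependent {θ : Fin 4 → (V →L[ℝ] ℝ)} {e : Fin 4 → V} (hd : IsDual θ e) :
    LinearIndependent ℝ e := by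
  rw [Fintype.linearIndependent_iff]
  intro g hg i
  have := congrArg (θ i) hg
  simpa [hd i] using this

theorem IsDual.ext {θ : Fin 4 → (V →L[ℝ] ℝ)} {e : Fin 4 → V} (hd : IsDual θ e)
    (hV : finrank ℝ V = 4) {p : ℕ} {α β : V [⋀^Fin p]→L[ℝ] ℝ}
    (h : ∀ j : Fin p → Fin 4, α (fun i => e (j i)) = β (fun i => e (j i))) : α = β := by
  apply ContinuousAlternatingMap.toContinuousMultilinearMap_injective
  apply ContinuousMultilinearMap.toMultilinearMap_injective
  refine Basis.ext_multilinear
    (fun _ => basisOfLinearIndependentOfCardEqFinrank hd.linearIndependent (by simp [hV])) ?_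
  intro j
  simpa using h j

/-- Expansion in fixed forms, which reduces differentiability of a form-valued map to that of its
values on fixed vectors. -/
theorem IsDual.eq_sum_wedgeProd {θ : Fin 4 → (V →L[ℝ] ℝ)} {e : Fin 4 → V} (hd : IsDual θ e)
    (hV : finrank ℝ V = 4) {p : ℕ} (α : V [⋀^Fin p]→L[ℝ] ℝ) :
    α = ∑ a : Fin p → Fin 4, α (fun i => e (a i)) •
      ((p.factorial : ℝ)⁻¹ • wedgeProd p (fun i => θ (a i))) := by
  have hp : (p.factorial : ℝ) ≠ 0 := by positivity
  refine hd.ext hV fun j => ?_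
  have := (isAntisymm_apply α e).sum_mul_wedgeProd' θ (fun i => e (j i))
  rw [hd.sum_mul_prod] at this
  simp only [ContinuousAlternatingMap.sum_apply, ContinuousAlternatingMap.smul_apply, smul_eq_mul]
  rw [eq_comm, ← inv_mul_cancel_left₀ hp (α fun i => e (j i)), ← this, Finset.mul_sum]
  exact Finset.sum_congr rfl fun _ _ => by ring

end Linear

/-! ### Forms and the coframe in the preferred chart -/

section Manifold
open Filter Topology

variable {M : Type*} [TopologicalSpace M] [ChartedSpace (EuclideanSpace ℝ (Fin 4)) M]

theorem inChart_apply {p : ℕ} (α : DForm M p) (x : M) (y : EuclideanSpace ℝ (Fin 4))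
    (v : Fin p → EuclideanSpace ℝ (Fin 4)) :
    inChart α x y v = α ((extChartAt (𝓡 4) x).symm y)
      (fun i => mfderiv (𝓡 4) (𝓡 4) (extChartAt (𝓡 4) x).symm y (v i)) := rfl

variable [IsManifold (𝓡 4) ∞ M]

/-- The tangent space at `x` is identified with the model space by the preferred chart at `x`
itself, so no Jacobian appears at the base point. -/
theorem mfderiv_extChartAt_symm_self (x : M) :
    mfderiv (𝓡 4) (𝓡 4) (extChartAt (𝓡 4) x).symm (extChartAt (𝓡 4) x x) =
      ContinuousLinearMap.id ℝ (EuclideanSpace ℝ (Fin 4)) := by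
  have := IsManifold.of_le (I := 𝓡 4) (M := M) (n := ∞) (m := 1) (by simp)
  have h := mfderivWithin_range_extChartAt_symm (I := 𝓡 4) (x := x)
  simp only [modelWithCornersSelf_coe, Set.range_id, mfderivWithin_univ] at h
  exact h

theorem extD_apply {p : ℕ} (α : DForm M p) (x : M) (v : Fin (p + 1) → TangentSpace (𝓡 4) x) :
    extD α x v = extDeriv (inChart α x) (extChartAt (𝓡 4) x x) v := by
  have := IsManifold.of_le (I := 𝓡 4) (M := M) (n := ∞) (m := 1) (by simp)
  have h : mfderiv (𝓡 4) (𝓡 4) (extChartAt (𝓡 4) x) x =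
      ContinuousLinearMap.id ℝ (EuclideanSpace ℝ (Fin 4)) :=
    mfderiv_extChartAt_self (I := 𝓡 4) (x := x)
  unfold extD
  rw [h]
  rfl

namespace Coframe
variable (ϑ : Coframe M)

theorem isDual (x : M) : IsDual (V := TangentSpace (𝓡 4) x) (fun a => ϑ.toFun a x) (ϑ.frame x) :=
  ϑ.apply_frame x

/-- The coordinate expression of `ϑ^a` in the preferred chart at `x`. -/
def coord (x : M) (a : Fin 4) (y : EuclideanSpace ℝ (Fin 4)) : EuclideanSpace ℝ (Fin 4) →L[ℝ] ℝ :=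
  (ϑ.toFun a ((extChartAt (𝓡 4) x).symm y)).comp
    (mfderiv (𝓡 4) (𝓡 4) (extChartAt (𝓡 4) x).symm y)

theorem coord_self (x : M) (a : Fin 4) : ϑ.coord x a (extChartAt (𝓡 4) x x) =
    ϑ.toFun a x := by
  unfold coord
  rw [mfderiv_extChartAt_symm_self]
  ext v
  change ϑ.toFun a ((extChartAt (𝓡 4) x).symm (extChartAt (𝓡 4) x x)) v = ϑ.toFun a x v
  congr 2
  exact extChartAt_to_inv (I := 𝓡 4) x

/-- The dual frame at `x`, as vectors of the model space. -/
def frameVec (x : M) : Fin 4 → EuclideanSpace ℝ (Fin 4) := ϑ.frame x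

theorem isDual_coord (x : M) : IsDual (V := EuclideanSpace ℝ (Fin 4))
    (fun a => ϑ.coord x a (extChartAt (𝓡 4) x x)) (ϑ.frameVec x) := by
  intro a b
  exact (congrArg (fun L : EuclideanSpace ℝ (Fin 4) →L[ℝ] ℝ => L (ϑ.frameVec x b))
    (ϑ.coord_self x a)).trans (ϑ.apply_frame x a b)

theorem differentiableAt_coord (x : M) (a : Fin 4) :
    DifferentiableAt ℝ (ϑ.coord x a) (extChartAt (𝓡 4) x x) := by
  have := IsManifold.of_le (I := 𝓡 4) (M := M) (n := ∞) (m := 1) (by simp)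
  have h1 := ((contMDiffAt_hom_bundle _).1 (ϑ.smooth a x)).2
  have h2 := (contMDiffAt_iff.1 h1).2
  simp only [modelWithCornersSelf_coe, Set.range_id, contDiffWithinAt_univ] at h2
  refine (h2.differentiableAt (by simp)).congr_of_eventuallyEq ?_
  have h3 : ∀ᶠ y in 𝓝 (extChartAt (𝓡 4) x x), y ∈ (extChartAt (𝓡 4) x).target :=
    extChartAt_target_mem_nhds x
  filter_upwards [h3] with y hy
  have hs : (extChartAt (𝓡 4) x).symm y ∈ (chartAt (EuclideanSpace ℝ (Fin 4)) x).source := by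
    rw [← extChartAt_source (𝓡 4)]
    exact (extChartAt (𝓡 4) x).map_target hy
  -- Smoothness of the section is smoothness in the bundle trivialization at `x`; on the chart
  -- target that trivialization is inverted by the derivative of the inverse chart, so it gives
  -- `coord`.
  have h4 := TangentBundle.symmL_trivializationAt (I := 𝓡 4) hs
  rw [(extChartAt (𝓡 4) x).right_inv hy] at h4
  simp only [modelWithCornersSelf_coe, Set.range_id, mfderivWithin_univ] at h4
  ext v
  have h5 := congrArg (fun L => ϑ.toFun a ((extChartAt (𝓡 4) x).symm y) (L v)) h4
  simp only [coord]
  refine h5.symm.trans ?_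
  simp [ContinuousLinearMap.inCoordinates]
  rfl

end Coframe

theorem differentiableAt_of_apply {E : Type*} [NormedAddCommGroup E] [NormedSpace ℝ E]
    {θ : Fin 4 → (E →L[ℝ] ℝ)} {e : Fin 4 → E} (hd : IsDual θ e) (hE : finrank ℝ E = 4) {p : ℕ}
    {α : E → E [⋀^Fin p]→L[ℝ] ℝ} {x : E} (h : ∀ v, DifferentiableAt ℝ (fun y => α y v) x) :
    DifferentiableAt ℝ α x := by
  rw [show α = fun y => _ from funext fun y => hd.eq_sum_wedgeProd hE (α y)]
  exact DifferentiableAt.fun_sum fun a _ => (h _).smul_const _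

theorem fderiv_form_apply {E : Type*} [NormedAddCommGroup E] [NormedSpace ℝ E] {p : ℕ}
    {α : E → E [⋀^Fin p]→L[ℝ] ℝ} {x : E} (h : DifferentiableAt ℝ α x) (u : E) (v : Fin p → E) :
    fderiv ℝ α x u v = fderiv ℝ (fun y => α y v) x u :=
  (fderiv_continuousAlternatingMap_apply_const_apply h v u).symm

end Manifold

/-! ### First derivatives of dual basis forms at the base point -/

section Manifold
open Filter Topology

variable {M : Type*} [TopologicalSpace M] [ChartedSpace (EuclideanSpace ℝ (Fin 4)) M]
  [IsManifold (𝓡 4) ∞ M]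

theorem hasFDerivAt_prod_apply {E : Type*} [NormedAddCommGroup E] [NormedSpace ℝ E] {q : ℕ}
    {θ : Fin 4 → E → (E →L[ℝ] ℝ)} {x : E} (h : ∀ a, DifferentiableAt ℝ (θ a) x)
    (b : Fin q → Fin 4) (v : Fin q → E) :
    HasFDerivAt (fun y => ∏ l, θ (b l) y (v l))
      (∑ k, (∏ l ∈ Finset.univ.erase k, θ (b l) x (v l)) •
        fderiv ℝ (fun y => θ (b k) y (v k)) x) x :=
  HasFDerivAt.finsetProd fun k _ =>
    ((h (b k)).clm_apply (differentiableAt_const _)).hasFDerivAt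

namespace Coframe
variable (ϑ : Coframe M)

/-- The coordinate expression of `ϑ_a` in the preferred chart at `x`. -/
def coordLower (x : M) (a : Fin 4) (y : EuclideanSpace ℝ (Fin 4)) :
    EuclideanSpace ℝ (Fin 4) →L[ℝ] ℝ :=
  lowerCoframe (fun b => ϑ.coord x b y) a

theorem differentiableAt_coordLower (x : M) (a : Fin 4) :
    DifferentiableAt ℝ (ϑ.coordLower x a) (extChartAt (𝓡 4) x x) := by
  unfold coordLower lowerCoframe
  exact DifferentiableAt.fun_sum fun m _ => (ϑ.differentiableAt_coord x m).fun_const_smul _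

theorem coordLower_frameVec (x : M) (a b : Fin 4) :
    ϑ.coordLower x a (extChartAt (𝓡 4) x x) (ϑ.frameVec x b) = eta a b :=
  (ϑ.isDual_coord x).lowerCoframe_apply a b

/-- The derivatives `(∂_{e_r} ϑ_m)(e_s)` in the preferred chart at `x`. -/
def jet (x : M) (m r s : Fin 4) : ℝ :=
  fderiv ℝ (fun y => ϑ.coordLower x m y (ϑ.frameVec x s)) (extChartAt (𝓡 4) x x) (ϑ.frameVec x r)

theorem star_basis {n q : ℕ} (h : n + q = 4) (a : Fin n → Fin 4) :
    ϑ.star h (ϑ.basis a) = fun x => (q.factorial : ℝ)⁻¹ • ∑ b, eps h a b •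
      wedgeProd q (fun j => lowerCoframe (fun c => ϑ.toFun c x) (b j)) :=
  funext fun x => (ϑ.isDual x).hodge_wedgeProd h a

theorem inChart_star_basis {n q : ℕ} (h : n + q = 4) (a : Fin n → Fin 4) (x : M)
    (y : EuclideanSpace ℝ (Fin 4)) (v : Fin q → EuclideanSpace ℝ (Fin 4)) :
    inChart (ϑ.star h (ϑ.basis a)) x y v = (q.factorial : ℝ)⁻¹ * ∑ b, eps h a b *
      wedgeProd q (fun l => ϑ.coordLower x (b l) y) v := by
  rw [star_basis, inChart_apply]
  simp only [ContinuousAlternatingMap.smul_apply, ContinuousAlternatingMap.sum_apply, smul_eq_mul]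
  refine congrArg _ (Finset.sum_congr rfl fun b _ => congrArg _ ?_)
  rw [wedgeProd_apply, wedgeProd_apply]
  refine Finset.sum_congr rfl fun σ _ => congrArg _ (Finset.prod_congr rfl fun l _ => ?_)
  simp only [coordLower, lowerCoframe, sum_apply, smul_apply]
  rfl

/-- Antisymmetry of `eps` absorbs `1/q!` and the alternation, leaving plain products to which the
Leibniz rule applies. -/
theorem inChart_star_basis' {n q : ℕ} (h : n + q = 4) (a : Fin n → Fin 4) (x : M)
    (y : EuclideanSpace ℝ (Fin 4)) (v : Fin q → EuclideanSpace ℝ (Fin 4)) :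
    inChart (ϑ.star h (ϑ.basis a)) x y v =
      ∑ b, eps h a b * ∏ l, ϑ.coordLower x (b l) y (v l) := by
  have hq : (q.factorial : ℝ) ≠ 0 := by positivity
  rw [inChart_star_basis,
    (isAntisymm_eps_right h a).sum_mul_wedgeProd' (fun b => ϑ.coordLower x b y) v,
    inv_mul_cancel_left₀ hq]

theorem hasFDerivAt_inChart_star_basis {n q : ℕ} (h : n + q = 4) (a : Fin n → Fin 4) (x : M)
    (v : Fin q → EuclideanSpace ℝ (Fin 4)) :
    HasFDerivAt (fun y => inChart (ϑ.star h (ϑ.basis a)) x y v)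
      (∑ b, eps h a b • ∑ k, (∏ l ∈ Finset.univ.erase k,
        ϑ.coordLower x (b l) (extChartAt (𝓡 4) x x) (v l)) •
          fderiv ℝ (fun y => ϑ.coordLower x (b k) y (v k)) (extChartAt (𝓡 4) x x))
      (extChartAt (𝓡 4) x x) := by
  simp_rw [inChart_star_basis']
  exact HasFDerivAt.fun_sum fun b _ =>
    (hasFDerivAt_prod_apply (fun a => ϑ.differentiableAt_coordLower x a) b v).const_mul _

theorem differentiableAt_inChart_star_basis {n q : ℕ} (h : n + q = 4) (a : Fin n → Fin 4) (x : M) :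
    DifferentiableAt ℝ (inChart (ϑ.star h (ϑ.basis a)) x) (extChartAt (𝓡 4) x x) :=
  differentiableAt_of_apply (ϑ.isDual_coord x) finrank_euclideanSpace_fin
    fun v => (ϑ.hasFDerivAt_inChart_star_basis h a x v).differentiableAt

theorem fderiv_inChart_star_basis {n q : ℕ} (h : n + q = 4) (a : Fin n → Fin 4) (x : M)
    (r : Fin 4) (i : Fin q → Fin 4) :
    fderiv ℝ (inChart (ϑ.star h (ϑ.basis a)) x) (extChartAt (𝓡 4) x x) (ϑ.frameVec x r)
      (fun l => ϑ.frameVec x (i l)) =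
    ∑ b, eps h a b * ∑ k, (∏ l ∈ Finset.univ.erase k, eta (b l) (i l)) *
      ϑ.jet x (b k) r (i k) := by
  rw [fderiv_form_apply (ϑ.differentiableAt_inChart_star_basis h a x),
    (ϑ.hasFDerivAt_inChart_star_basis h a x _).fderiv]
  simp only [coordLower_frameVec, sum_apply, smul_apply, smul_eq_mul]
  rfl

/-- At the base point the undifferentiated factors become `η` and contract the two symbols over `k`
indices. The exterior derivative contributes `k + 2` equal terms and the Leibniz rule `k + 1`, which
turns `1/(k+2)!` into `1/k!`. -/
theorem star_extD_star_basis_apply {n k p : ℕ} (h : n + (k + 1) = 4) (h' : k + 1 + 1 + p = 4)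
    (a : Fin n → Fin 4) (x : M) (j : Fin p → Fin 4) :
    ϑ.star h' (extD (ϑ.star h (ϑ.basis a))) x (fun l => ϑ.frame x (j l)) =
      (k.factorial : ℝ)⁻¹ * (∑ r : Fin 4, ∑ m : Fin 4, ∑ s : Fin 4, ∑ i : Fin k → Fin 4,
        eps h a (Fin.cons m i) * eps h' (Fin.cons r (Fin.cons s i)) j * etaProd i *
          ϑ.jet x m r s) * etaProd j := by
  rw [star, (ϑ.isDual x).hodge_apply]
  have h1 : ∑ c, eps h' c j * extD (ϑ.star h (ϑ.basis a)) x (fun i => ϑ.frame x (c i)) =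
      ∑ c, eps h' c j * ContinuousAlternatingMap.alternatizeUncurryFin
        (fderiv ℝ (inChart (ϑ.star h (ϑ.basis a)) x) (extChartAt (𝓡 4) x x))
        (fun i => ϑ.frameVec x (c i)) :=
    Finset.sum_congr rfl fun c _ => congrArg _ (extD_apply _ x _)
  rw [h1, (isAntisymm_eps_left h' j).sum_mul_alternatizeUncurryFin]
  simp_rw [fderiv_inChart_star_basis]
  have h2 : ∀ r : Fin 4, ∑ i : Fin (k + 1) → Fin 4, eps h' (Fin.cons r i) j *
      ∑ b, eps h a b * ∑ l, (∏ l' ∈ Finset.univ.erase l, eta (b l') (i l')) *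
        ϑ.jet x (b l) r (i l) = (k + 1) * ∑ m : Fin 4, ∑ s : Fin 4, ∑ i : Fin k → Fin 4,
        eps h a (Fin.cons m i) * eps h' (Fin.cons r (Fin.cons s i)) j * etaProd i *
          ϑ.jet x m r s := by
    intro r
    have hG : IsAntisymm fun i : Fin (k + 1) → Fin 4 =>
        eps h' (Fin.cons (α := fun _ => Fin 4) r i) j := (isAntisymm_eps_left h' j).cons r
    rw [← hG.sum_mul_sum_update (isAntisymm_eps_right h a)
      (fun m s => ϑ.jet x m r s), Finset.sum_comm]
    simp_rw [Finset.mul_sum (ι := Fin (k + 1) → Fin 4)]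
    exact Finset.sum_congr rfl fun i _ => Finset.sum_congr rfl fun b _ => by ring
  rw [Finset.sum_congr rfl fun r _ => h2 r, ← Finset.mul_sum, Nat.factorial_succ,
    Nat.factorial_succ]
  have hk : (k.factorial : ℝ) ≠ 0 := by positivity
  push_cast
  field_simp

/-- The dual of a basis 4-form is a constant function. -/
theorem extD_star_basis_eq_zero (h : 4 + 0 = 4) (a : Fin 4 → Fin 4) :
    extD (ϑ.star h (ϑ.basis a)) = 0 := by
  funext x
  ext v
  rw [extD_apply]
  have : inChart (ϑ.star h (ϑ.basis a)) x = fun _ => zeroForm (∑ b, eps h a b) := by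
    funext y
    ext v
    rw [inChart_star_basis']
    simp [zeroForm]
  have h0 : extDeriv (fun _ : EuclideanSpace ℝ (Fin 4) =>
      zeroForm (V := EuclideanSpace ℝ (Fin 4)) (∑ b, eps h a b)) (extChartAt (𝓡 4) x x) = 0 := by
    rw [extDeriv, fderiv_fun_const]
    exact map_zero (ContinuousAlternatingMap.alternatizeUncurryFinCLM ℝ _ _)
  rw [this, h0]
  rfl

theorem coord_eq (x : M) (a : Fin 4) (y : EuclideanSpace ℝ (Fin 4)) :
    ϑ.coord x a y = eta a a • ϑ.coordLower x a y := by
  have : eta a a * eta a a = 1 := by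
    rw [eta, if_pos rfl]; split_ifs <;> norm_num
  rw [coordLower, lowerCoframe, Fintype.sum_eq_single a fun m hm => by
    rw [eta_of_ne hm.symm, zero_smul], smul_smul, this, one_smul]

theorem extD_oneForm_apply (ϑ : Coframe M) {α : DForm M 1} {x : M}
    {θ : EuclideanSpace ℝ (Fin 4) → (EuclideanSpace ℝ (Fin 4) →L[ℝ] ℝ)}
    (hθ : DifferentiableAt ℝ θ (extChartAt (𝓡 4) x x))
    (hα : ∀ y v, inChart α x y v = θ y (v 0)) (v : Fin 2 → EuclideanSpace ℝ (Fin 4)) :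
    extD α x v = fderiv ℝ (fun y => θ y (v 1)) (extChartAt (𝓡 4) x x) (v 0) -
      fderiv ℝ (fun y => θ y (v 0)) (extChartAt (𝓡 4) x x) (v 1) := by
  have hd : DifferentiableAt ℝ (inChart α x) (extChartAt (𝓡 4) x x) := by
    refine differentiableAt_of_apply (ϑ.isDual_coord x) finrank_euclideanSpace_fin fun v => ?_
    simp only [hα]
    exact hθ.clm_apply (differentiableAt_const _)
  refine (extD_apply α x v).trans ?_
  rw [extDeriv_apply hd, Fin.sum_univ_two]
  simp only [hα]
  simp [Fin.removeNth, sub_eq_add_neg]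

theorem anhol_eq (x : M) (a r s : Fin 4) :
    ϑ.anhol a r s x = eta a a * (ϑ.jet x a r s - ϑ.jet x a s r) := by
  refine (ϑ.extD_oneForm_apply (ϑ.differentiableAt_coord x a) (fun y v => rfl)
    ![ϑ.frameVec x r, ϑ.frameVec x s]).trans ?_
  simp only [coord_eq, smul_apply, smul_eq_mul, Matrix.cons_val_zero, Matrix.cons_val_one]
  have h : ∀ v, DifferentiableAt ℝ (fun y => ϑ.coordLower x a y v) (extChartAt (𝓡 4) x x) :=
    fun v => (ϑ.differentiableAt_coordLower x a).clm_apply (differentiableAt_const _)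
  rw [fderiv_const_mul (h _), fderiv_const_mul (h _), smul_apply, smul_apply, mul_sub]
  rfl

theorem extD_down_apply (x : M) (a : Fin 4) (c : Fin 2 → Fin 4) :
    extD (ϑ.down a) x (fun l => ϑ.frame x (c l)) =
      ϑ.jet x a (c 0) (c 1) - ϑ.jet x a (c 1) (c 0) := by
  refine ϑ.extD_oneForm_apply (ϑ.differentiableAt_coordLower x a) (fun y v => ?_)
    (fun l => ϑ.frameVec x (c l))
  simp only [coordLower, lowerCoframe, sum_apply, smul_apply]
  rw [inChart_apply]
  simp only [down, lowerCoframe, oneForm, ContinuousAlternatingMap.ofSubsingleton_apply_apply]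
  simp only [sum_apply, smul_apply]
  rfl

end Coframe
end Manifold

/-! ### Contractions of the antisymmetric symbol -/

section Symbols

/-- The completely antisymmetric symbol as an integer, by the Vandermonde formula. -/
def epsInt (a b c d : Fin 4) : ℤ :=
  ((b : ℤ) - a) * ((c : ℤ) - a) * ((d : ℤ) - a) * ((c : ℤ) - b) * ((d : ℤ) - b) * ((d : ℤ) - c) / 12

/-- The Minkowski matrix with integer entries. -/
def etaInt (a b : Fin 4) : ℤ := if a = b then (if a = 0 then 1 else -1) else 0

/-- The Kronecker symbol. -/
def delta (a b : Fin 4) : ℤ := if a = b then 1 else 0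

/-- The components of `θ^c ∧ θ^d`. -/
def delta₂ (c d j k : Fin 4) : ℤ := delta c j * delta d k - delta c k * delta d j

/-- The components of `θ^a ∧ θ^b` with both indices raised. -/
def etaInt₂ (r s a b : Fin 4) : ℤ := etaInt r a * etaInt s b - etaInt r b * etaInt s a

/-- The product of differences is `12` at `0123` and takes only the values `0` and `±12`, so the
integer division is exact. Integer values let the contraction identities be decided by evaluation.
-/
theorem epsilon_eq (f : Fin 4 → Fin 4) : epsilon f = epsInt (f 0) (f 1) (f 2) (f 3) := by
  have : ∀ a b c d : Fin 4, (Matrix.of fun i j : Fin 4 =>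
      if ![a, b, c, d] i = j then (1 : ℤ) else 0).det = epsInt a b c d := by
    intro a b c d
    simp [Matrix.det_succ_row_zero, Fin.sum_univ_succ, Fin.succAbove]
    revert a b c d
    decide +kernel
  rw [epsilon, ← this]
  congr 4
  funext i
  fin_cases i <;> rfl

theorem eta_eq (a b : Fin 4) : eta a b = etaInt a b := by
  simp only [eta, etaInt]; split_ifs <;> simp

theorem epsInt_swap : ∀ a b c d : Fin 4, epsInt b a c d = -epsInt a b c d := by
  decide +kernel

theorem epsInt_swap' : ∀ a b c d : Fin 4, epsInt a b d c = -epsInt a b c d := by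
  decide +kernel

theorem etaInt₂_swap (r s a b : Fin 4) : etaInt₂ s r a b = -etaInt₂ r s a b := by
  unfold etaInt₂; ring

theorem delta₂_swap (c d j k : Fin 4) : delta₂ c d k j = -delta₂ c d j k := by
  unfold delta₂; ring

/-- The sign is `det η = -1`; the `2` counts orderings of the contracted pair. -/
theorem epsInt_contract_two : ∀ r s a b : Fin 4, ∑ i : Fin 4, ∑ k : Fin 4,
    etaInt i i * etaInt k k * epsInt r s i k * epsInt a b i k = -2 * etaInt₂ r s a b := by
  decide +kernel

theorem epsInt_contract_one (r s a b c j : Fin 4) : ∑ i : Fin 4,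
    etaInt i i * etaInt j j * epsInt r s i j * epsInt a b c i =
      etaInt₂ r s a b * delta c j - etaInt₂ r s a c * delta b j + etaInt₂ r s b c * delta a j := by
  -- Antisymmetry in `r, s` roughly halves the cases to be evaluated.
  have key : ∀ r s : Fin 4, r ≤ s → ∀ a b c j : Fin 4, ∑ i : Fin 4,
      etaInt i i * etaInt j j * epsInt r s i j * epsInt a b c i =
      etaInt₂ r s a b * delta c j - etaInt₂ r s a c * delta b j + etaInt₂ r s b c * delta a j := by
    decide +kernel
  rcases le_total r s with h | h
  · exact key r s h a b c j
  · simp only [epsInt_swap s r, etaInt₂_swap s r, mul_neg, neg_mul, Finset.sum_neg_distrib,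
      key s r h]
    ring

/-- The product of two symbols is `det η` times a determinant of metric entries; this is its Laplace
expansion along the rows `r, s`, with `j, k` lowered. -/
theorem epsInt_contract_zero (r s j k a b c d : Fin 4) :
    etaInt j j * etaInt k k * epsInt r s j k * epsInt a b c d =
      -(etaInt₂ r s a b * delta₂ c d j k - etaInt₂ r s a c * delta₂ b d j k +
        etaInt₂ r s a d * delta₂ b c j k + etaInt₂ r s b c * delta₂ a d j k -
        etaInt₂ r s b d * delta₂ a c j k + etaInt₂ r s c d * delta₂ a b j k) := by
  have key : ∀ r s : Fin 4, r ≤ s → ∀ j k : Fin 4, j ≤ k → ∀ a b c d : Fin 4,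
      etaInt j j * etaInt k k * epsInt r s j k * epsInt a b c d =
      -(etaInt₂ r s a b * delta₂ c d j k - etaInt₂ r s a c * delta₂ b d j k +
        etaInt₂ r s a d * delta₂ b c j k + etaInt₂ r s b c * delta₂ a d j k -
        etaInt₂ r s b d * delta₂ a c j k + etaInt₂ r s c d * delta₂ a b j k) := by
    decide +kernel
  have key' : ∀ r s : Fin 4, r ≤ s →
      etaInt j j * etaInt k k * epsInt r s j k * epsInt a b c d =
      -(etaInt₂ r s a b * delta₂ c d j k - etaInt₂ r s a c * delta₂ b d j k +
        etaInt₂ r s a d * delta₂ b c j k + etaInt₂ r s b c * delta₂ a d j k -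
        etaInt₂ r s b d * delta₂ a c j k + etaInt₂ r s c d * delta₂ a b j k) := by
    intro r s h
    rcases le_total j k with h' | h'
    · exact key r s h j k h' a b c d
    · simp only [epsInt_swap' _ _ k j, delta₂_swap _ _ k j]
      linear_combination -key r s h k j h' a b c d
  rcases le_total r s with h | h
  · exact key' r s h
  · simp only [epsInt_swap s r, etaInt₂_swap s r]
    linear_combination -key' s r h

theorem sum_fin_succ {p : ℕ} (f : (Fin (p + 1) → Fin 4) → ℝ) :
    ∑ a, f a = ∑ r : Fin 4, ∑ a : Fin p → Fin 4, f (Fin.cons (α := fun _ => Fin 4) r a) := by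
  rw [sum_eq_sum_insertNth 0]
  simp

end Symbols

/-! ### Frame components and anholonomity in terms of jets -/

section Manifold
variable {M : Type*} [TopologicalSpace M] [ChartedSpace (EuclideanSpace ℝ (Fin 4)) M]
  [IsManifold (𝓡 4) ∞ M]

namespace Coframe
variable (ϑ : Coframe M)

/-- Replaces the truncated subtraction `3 - p` by a free degree `q`. -/
theorem codiff_eq {p q : ℕ} (hp : p + 1 ≤ 4) (h : p + 1 + q = 4) (h' : q + 1 + p = 4)
    (α : DForm M (p + 1)) : ϑ.codiff hp α = -ϑ.star h' (extD (ϑ.star h α)) := by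
  obtain rfl : q = 3 - p := by omega
  rfl

theorem ext {p : ℕ} {α β : DForm M p}
    (h : ∀ x (j : Fin p → Fin 4), α x (fun i => ϑ.frame x (j i)) = β x (fun i => ϑ.frame x (j i))) :
    α = β :=
  funext fun x => (ϑ.isDual x).ext (finrank_euclideanSpace_fin (𝕜 := ℝ) (n := 4)) (h x)

theorem anholMixed_eq (m a b : Fin 4) (x : M) :
    ϑ.anholMixed m a b x = eta a a * eta b b * (ϑ.jet x m a b - ϑ.jet x m b a) := by
  have h : eta m m * eta m m = 1 := by rw [eta, if_pos rfl]; split_ifs <;> norm_num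
  unfold anholMixed
  rw [Fintype.sum_eq_single m fun n hn => by simp [eta_of_ne hn.symm],
    Fintype.sum_eq_single a fun n hn => by simp [eta_of_ne hn.symm],
    Fintype.sum_eq_single b fun n hn => by simp [eta_of_ne hn.symm], anhol_eq]
  linear_combination (eta a a * eta b b * (ϑ.jet x m a b - ϑ.jet x m b a)) * h

/-- The individual jets depend on the chart; the antisymmetric coefficient retains only the part
that comes from `dϑ_m`. -/
theorem sum_etaInt₂_mul_jet (x : M) (m a b : Fin 4) :
    ∑ r, ∑ s, (etaInt₂ r s a b : ℝ) * ϑ.jet x m r s = ϑ.anholMixed m a b x := by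
  have h : ∀ a b : Fin 4, ∑ r, ∑ s, eta r a * eta s b * ϑ.jet x m r s =
      eta a a * eta b b * ϑ.jet x m a b := fun a b => by
    rw [Fintype.sum_eq_single a fun n hn => by simp [eta_of_ne hn],
      Fintype.sum_eq_single b fun n hn => by simp [eta_of_ne hn]]
  simp only [etaInt₂, Int.cast_sub, Int.cast_mul, ← eta_eq, sub_mul, Finset.sum_sub_distrib, h,
    anholMixed_eq]
  ring

theorem anholTraceUp_eq (a : Fin 4) (x : M) :
    ϑ.anholTraceUp a x = ∑ m, ϑ.anholMixed m a m x := by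
  unfold anholTraceUp
  rw [Fintype.sum_eq_single a fun n hn => by rw [eta_of_ne hn.symm, zero_mul], anholTrace,
    Finset.mul_sum]
  refine Finset.sum_congr rfl fun m _ => ?_
  rw [anhol_eq, anholMixed_eq, mul_assoc]

theorem basis_one (a : Fin 4) : ϑ.basis ![a] = ϑ.up a := by
  funext x
  ext v
  simp [basis, up, wedgeProd_apply, oneForm]

theorem apply_frame_eq_delta (x : M) (a b : Fin 4) :
    ϑ.toFun a x (ϑ.frame x b) = delta a b := by
  rw [apply_frame, delta]
  split_ifs <;> simp

theorem basis_one_apply (a : Fin 4) (x : M) (j : Fin 1 → Fin 4) :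
    ϑ.up a x (fun i => ϑ.frame x (j i)) = delta a (j 0) := by
  simp [up, oneForm, apply_frame_eq_delta]

theorem basis_two_apply (a b : Fin 4) (x : M) (j : Fin 2 → Fin 4) :
    ϑ.basis ![a, b] x (fun i => ϑ.frame x (j i)) = delta₂ a b (j 0) (j 1) := by
  have : (Finset.univ : Finset (Equiv.Perm (Fin 2))) = {1, Equiv.swap 0 1} := by decide
  rw [basis, wedgeProd_apply, this, Finset.sum_pair (by decide)]
  have hs : Equiv.Perm.sign (Equiv.swap (0 : Fin 2) 1) = -1 := Equiv.Perm.sign_swap (by decide)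
  simp only [Fin.prod_univ_two, apply_frame_eq_delta, delta₂, hs, Equiv.Perm.sign_one,
    Equiv.Perm.one_apply, Equiv.swap_apply_left, Equiv.swap_apply_right, Matrix.cons_val_zero,
    Matrix.cons_val_one]
  push_cast
  ring

end Coframe
end Manifold

/-! ### Closed formulas for the coderivative -/

section Manifold
variable {M : Type*} [TopologicalSpace M] [ChartedSpace (EuclideanSpace ℝ (Fin 4)) M]
  [IsManifold (𝓡 4) ∞ M]

namespace Coframe
variable (ϑ : Coframe M)

theorem codiff_basis_apply {p k : ℕ} (hp : p + 1 ≤ 4) (h : p + 1 + (k + 1) = 4)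
    (h' : k + 1 + 1 + p = 4) (a : Fin (p + 1) → Fin 4) (x : M) (j : Fin p → Fin 4) :
    ϑ.codiff hp (ϑ.basis a) x (fun l => ϑ.frame x (j l)) =
      -∑ m : Fin 4, ∑ r : Fin 4, ∑ s : Fin 4, ((k.factorial : ℝ)⁻¹ * ∑ i : Fin k → Fin 4,
        eps h a (Fin.cons m i) * eps h' (Fin.cons r (Fin.cons s i)) j * etaProd i * etaProd j) *
          ϑ.jet x m r s := by
  rw [ϑ.codiff_eq hp h h', Pi.neg_apply, ContinuousAlternatingMap.neg_apply,
    star_extD_star_basis_apply, Finset.sum_comm]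
  simp_rw [Finset.mul_sum, Finset.sum_mul]
  refine congrArg _ <| Finset.sum_congr rfl fun m _ => Finset.sum_congr rfl fun r _ =>
    Finset.sum_congr rfl fun s _ => Finset.sum_congr rfl fun i _ => ?_
  ring

theorem codiff_up (h : 0 + 1 ≤ 4) (a : Fin 4) :
    ϑ.codiff (p := 0) h (ϑ.up a) = ofFun (ϑ.anholTraceUp a) := by
  refine ϑ.ext fun x j => ?_
  rw [← basis_one, ϑ.codiff_basis_apply (k := 2) _ rfl rfl]
  -- The `1/2!` cancels the `2` in `epsInt_contract_two`; the remaining sign cancels the minus of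
  -- `d†`.
  have key : ∀ m r s : Fin 4, ((Nat.factorial 2 : ℝ)⁻¹ * ∑ i : Fin 2 → Fin 4,
      eps (rfl : 0 + 1 + (2 + 1) = 4) ![a] (Fin.cons m i) *
        eps (rfl : 2 + 1 + 1 + 0 = 4) (Fin.cons r (Fin.cons s i)) j * etaProd i * etaProd j) =
      -etaInt₂ r s a m := by
    intro m r s
    have h1 : ∀ i : Fin 2 → Fin 4, eps (rfl : 0 + 1 + (2 + 1) = 4) ![a] (Fin.cons m i) =
      epsInt a m (i 0) (i 1) := fun i => epsilon_eq _
    have h2 : ∀ i : Fin 2 → Fin 4, eps (rfl : 2 + 1 + 1 + 0 = 4) (Fin.cons r (Fin.cons s i)) j =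
      epsInt r s (i 0) (i 1) := fun i => epsilon_eq _
    have := congrArg (Int.cast (R := ℝ)) (epsInt_contract_two r s a m)
    push_cast at this
    simp_rw [h1, h2, sum_fin_succ, Fintype.sum_unique, etaProd, Fin.prod_univ_two, eta_eq]
    simp
    rw [inv_mul_eq_iff_eq_mul₀ two_ne_zero, mul_neg, ← neg_mul, ← this]
    refine Finset.sum_congr rfl fun i _ => Finset.sum_congr rfl fun k _ => ?_
    ring
  simp_rw [key]
  simp [sum_etaInt₂_mul_jet, ofFun, zeroForm, anholTraceUp_eq]

theorem codiff_basis_two (h : 1 + 1 ≤ 4) (a b : Fin 4) :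
    ϑ.codiff (p := 1) h (ϑ.basis ![a, b]) =
      fsmul (ϑ.anholTraceUp a) (ϑ.up b) - fsmul (ϑ.anholTraceUp b) (ϑ.up a) -
        ∑ m : Fin 4, fsmul (ϑ.anholMixed m a b) (ϑ.up m) := by
  refine ϑ.ext fun x j => ?_
  rw [ϑ.codiff_basis_apply (k := 1) _ rfl rfl]
  -- Summed over `m`, the terms with `m` inside `etaInt₂` become the traces `C^a`, `C^b`; the term
  -- with `delta m` becomes `C_m^{ab} ϑ^m`.
  have key : ∀ m r s : Fin 4, ((Nat.factorial 1 : ℝ)⁻¹ * ∑ i : Fin 1 → Fin 4,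
      eps (rfl : 1 + 1 + (1 + 1) = 4) ![a, b] (Fin.cons m i) *
        eps (rfl : 1 + 1 + 1 + 1 = 4) (Fin.cons r (Fin.cons s i)) j * etaProd i * etaProd j) =
      etaInt₂ r s a b * delta m (j 0) - etaInt₂ r s a m * delta b (j 0) +
        etaInt₂ r s b m * delta a (j 0) := by
    intro m r s
    have h1 : ∀ i : Fin 1 → Fin 4, eps (rfl : 1 + 1 + (1 + 1) = 4) ![a, b] (Fin.cons m i) =
      epsInt a b m (i 0) := fun i => epsilon_eq _
    have h2 : ∀ i : Fin 1 → Fin 4, eps (rfl : 1 + 1 + 1 + 1 = 4) (Fin.cons r (Fin.cons s i)) j =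
      epsInt r s (i 0) (j 0) := fun i => epsilon_eq _
    have := congrArg (Int.cast (R := ℝ)) (epsInt_contract_one r s a b m (j 0))
    push_cast at this
    simp_rw [h1, h2, sum_fin_succ, Fintype.sum_unique, etaProd, Fin.prod_univ_one, eta_eq]
    simp
    rw [← this]
    refine Finset.sum_congr rfl fun i _ => ?_
    ring
  simp_rw [key]
  simp only [fsmul, Pi.sub_apply, Finset.sum_apply, ContinuousAlternatingMap.sub_apply,
    ContinuousAlternatingMap.smul_apply, ContinuousAlternatingMap.sum_apply, smul_eq_mul,
    basis_one_apply, anholTraceUp_eq, ← sum_etaInt₂_mul_jet, Finset.sum_mul,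
    ← Finset.sum_sub_distrib, ← Finset.sum_neg_distrib]
  refine Finset.sum_congr rfl fun m _ => Finset.sum_congr rfl fun r _ =>
    Finset.sum_congr rfl fun s _ => ?_
  ring

theorem codiff_basis_three (h : 2 + 1 ≤ 4) (a b c : Fin 4) :
    ϑ.codiff (p := 2) h (ϑ.basis ![a, b, c]) =
      fsmul (ϑ.anholTraceUp a) (ϑ.basis ![b, c]) - fsmul (ϑ.anholTraceUp b) (ϑ.basis ![a, c]) +
        fsmul (ϑ.anholTraceUp c) (ϑ.basis ![a, b]) +
        ∑ m : Fin 4, fsmul (ϑ.anholMixed m b c) (ϑ.basis ![a, m]) -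
        ∑ m : Fin 4, fsmul (ϑ.anholMixed m a c) (ϑ.basis ![b, m]) +
        ∑ m : Fin 4, fsmul (ϑ.anholMixed m a b) (ϑ.basis ![c, m]) := by
  refine ϑ.ext fun x j => ?_
  rw [ϑ.codiff_basis_apply (k := 0) _ rfl rfl]
  have key : ∀ m r s : Fin 4, ((Nat.factorial 0 : ℝ)⁻¹ * ∑ i : Fin 0 → Fin 4,
      eps (rfl : 2 + 1 + (0 + 1) = 4) ![a, b, c] (Fin.cons m i) *
        eps (rfl : 0 + 1 + 1 + 2 = 4) (Fin.cons r (Fin.cons s i)) j * etaProd i * etaProd j) =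
      -(etaInt₂ r s a b * delta₂ c m (j 0) (j 1) - etaInt₂ r s a c * delta₂ b m (j 0) (j 1) +
        etaInt₂ r s a m * delta₂ b c (j 0) (j 1) + etaInt₂ r s b c * delta₂ a m (j 0) (j 1) -
        etaInt₂ r s b m * delta₂ a c (j 0) (j 1) + etaInt₂ r s c m * delta₂ a b (j 0) (j 1)) := by
    intro m r s
    have h1 : ∀ i : Fin 0 → Fin 4, eps (rfl : 2 + 1 + (0 + 1) = 4) ![a, b, c] (Fin.cons m i) =
      epsInt a b c m := fun i => epsilon_eq _
    have h2 : ∀ i : Fin 0 → Fin 4, eps (rfl : 0 + 1 + 1 + 2 = 4) (Fin.cons r (Fin.cons s i)) j =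
      epsInt r s (j 0) (j 1) := fun i => epsilon_eq _
    have := congrArg (Int.cast (R := ℝ)) (epsInt_contract_zero r s (j 0) (j 1) a b c m)
    push_cast at this
    simp_rw [h1, h2, Fintype.sum_unique, etaProd, Fin.prod_univ_two, Fin.prod_univ_zero, eta_eq]
    rw [← this]
    simp
    ring
  simp_rw [key]
  simp only [fsmul, Pi.sub_apply, Pi.add_apply, Finset.sum_apply,
    ContinuousAlternatingMap.sub_apply, ContinuousAlternatingMap.add_apply,
    ContinuousAlternatingMap.smul_apply, ContinuousAlternatingMap.sum_apply, smul_eq_mul,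
    basis_two_apply, anholTraceUp_eq, ← sum_etaInt₂_mul_jet, Finset.sum_mul,
    ← Finset.sum_sub_distrib, ← Finset.sum_add_distrib, ← Finset.sum_neg_distrib]
  refine Finset.sum_congr rfl fun m _ => Finset.sum_congr rfl fun r _ =>
    Finset.sum_congr rfl fun s _ => ?_
  ring

theorem codiff_basis_four (h : 3 + 1 ≤ 4) (a : Fin 4 → Fin 4) :
    ϑ.codiff (p := 3) h (ϑ.basis a) = 0 := by
  rw [ϑ.codiff_eq (q := 0) _ rfl rfl, extD_star_basis_eq_zero]
  funext x
  simp [star, hodge]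

end Coframe
end Manifold

/-! ### Antisymmetrization in five indices -/

/-- The total antisymmetrization of `β ⊗ w` in five indices, for antisymmetric `β` and `w`. -/
def antisymmSum {N : Type*} [AddCommGroup N] [Module ℝ N] (β : Fin 4 → Fin 4 → ℝ)
    (w : Fin 4 → Fin 4 → Fin 4 → N) (a b c d e : Fin 4) : N :=
  β a b • w c d e - β a c • w b d e + β a d • w b c e - β a e • w b c d + β b c • w a d e -
    β b d • w a c e + β b e • w a c d + β c d • w a b e - β c e • w a b d + β d e • w a b c

/-- The antisymmetrization in five indices vanishes in dimension four. -/
theorem antisymmSum_eq_zero {N : Type*} [AddCommGroup N] [Module ℝ N] {β : Fin 4 → Fin 4 → ℝ}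
    {w : Fin 4 → Fin 4 → Fin 4 → N} (hβ : ∀ a b, β b a = -β a b)
    (hw : ∀ a b c, w b a c = -w a b c) (hw' : ∀ a b c, w a c b = -w a b c) (a b c d e : Fin 4) :
    antisymmSum β w a b c d e = 0 := by
  have h1 : ∀ a b c d e, antisymmSum β w b a c d e = -antisymmSum β w a b c d e := by
    intro a b c d e
    simp only [antisymmSum, hβ a b, hw a b]
    module
  have h2 : ∀ a b c d e, antisymmSum β w a c b d e = -antisymmSum β w a b c d e := by
    intro a b c d e
    simp only [antisymmSum, hβ b c, hw b c, hw' _ b c]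
    module
  have h3 : ∀ a b c d e, antisymmSum β w a b d c e = -antisymmSum β w a b c d e := by
    intro a b c d e
    simp only [antisymmSum, hβ c d, hw c d, hw' _ c d]
    module
  have h4 : ∀ a b c d e, antisymmSum β w a b c e d = -antisymmSum β w a b c d e := by
    intro a b c d e
    simp only [antisymmSum, hβ d e, hw' _ d e]
    module
  -- Equal neighbours give `S = -S`; adjacent swaps reduce every other coincidence to this one.
  have h12 : ∀ a c d e, antisymmSum β w a a c d e = 0 := fun a c d e => by
    have h : (2 : ℝ) • antisymmSum β w a a c d e = 0 := by
      rw [two_smul, ← eq_neg_iff_add_eq_zero]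
      exact h1 a a c d e
    exact (smul_eq_zero.1 h).resolve_left two_ne_zero
  have h13 : ∀ a b d e, antisymmSum β w a b a d e = 0 := fun a b d e => by
    rw [h2, h12, neg_zero]
  have h14 : ∀ a b c e, antisymmSum β w a b c a e = 0 := fun a b c e => by
    rw [h3, h13, neg_zero]
  have h15 : ∀ a b c d, antisymmSum β w a b c d a = 0 := fun a b c d => by
    rw [h4, h14, neg_zero]
  -- Pigeonhole: five indices take only four values.
  have key : ∀ a b c d e : Fin 4, a = b ∨ a = c ∨ a = d ∨ a = e ∨ b = c ∨ b = d ∨ b = e ∨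
      c = d ∨ c = e ∨ d = e := by
    decide
  rcases key a b c d e with rfl | rfl | rfl | rfl | rfl | rfl | rfl | rfl | rfl | rfl
  · exact h12 _ _ _ _
  · exact h13 _ _ _ _
  · exact h14 _ _ _ _
  · exact h15 _ _ _ _
  · rw [h1, h13, neg_zero]
  · rw [h1, h14, neg_zero]
  · rw [h1, h15, neg_zero]
  · rw [h2, h1, h14, neg_zero, neg_zero]
  · rw [h2, h1, h15, neg_zero, neg_zero]
  · rw [h3, h2, h1, h15, neg_zero, neg_zero, neg_zero]

/-! ### The recursion in degrees two, three and four -/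

section Manifold
variable {M : Type*} [TopologicalSpace M] [ChartedSpace (EuclideanSpace ℝ (Fin 4)) M]

/-- The exterior product with a fixed form on the left, as a linear map. -/
def wedgeLeft {V : Type*} [AddCommGroup V] [Module ℝ V] [TopologicalSpace V] {m n r : ℕ}
    (h : m + n = r) (α : V [⋀^Fin m]→L[ℝ] ℝ) :
    (V [⋀^Fin n]→L[ℝ] ℝ) →ₗ[ℝ] V [⋀^Fin r]→L[ℝ] ℝ where
  toFun := wedge h α
  map_add' β γ := by
    ext v
    simp only [ContinuousAlternatingMap.add_apply, wedge_apply, tensorMul_apply, mul_add,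
      Finset.sum_add_distrib]
  map_smul' c β := by
    ext v
    simp only [ContinuousAlternatingMap.smul_apply, wedge_apply, tensorMul_apply, smul_eq_mul,
      RingHom.id_apply, Finset.mul_sum]
    exact Finset.sum_congr rfl fun _ _ => by ring

theorem fwedge_apply {m n r : ℕ} (h : m + n = r) (α : DForm M m) (β : DForm M n) (x : M) :
    fwedge h α β x = wedgeLeft h (α x) (β x) := rfl

/-- The value of a form at a point on a tuple of tangent vectors. -/
def DForm.eval {p : ℕ} (α : DForm M p) (x : M) (v : Fin p → TangentSpace (𝓡 4) x) : ℝ := α x v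

theorem smul_eq_sum_smul_add_smul_sum_iff {p s : ℕ} (c c' : ℝ) (f : Fin s → ℝ) (α : DForm M p)
    (β : Fin s → DForm M p) (γ : Fin 4 → DForm M p) :
    c • α = ∑ i, f i • β i + c' • ∑ m, γ m ↔
      ∀ x v, c * α.eval x v = ∑ i, f i * (β i).eval x v + c' * ∑ m, (γ m).eval x v := by
  rw [funext_iff]
  refine forall_congr' fun x => ?_
  rw [ContinuousAlternatingMap.ext_iff]
  refine forall_congr' fun v => ?_
  simp only [DForm.eval, Pi.add_apply, Pi.smul_apply, Finset.sum_apply,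
    ContinuousAlternatingMap.add_apply, ContinuousAlternatingMap.smul_apply,
    ContinuousAlternatingMap.sum_apply, smul_eq_mul]

variable [IsManifold (𝓡 4) ∞ M]

namespace Coframe
variable (ϑ : Coframe M)

/-- Since `dϑ_m(e_r, e_s)` is the antisymmetrized jet, contracting it with the antisymmetric `S`
doubles the sum and removes the `1/2` coming from the 2-form factor. -/
theorem star_wedge_star_basis_apply {n q r' p : ℕ} (h : n + q = 4) (h1 : 2 + q = r')
    (h2 : r' + p = 4) (m : Fin 4) (a : Fin n → Fin 4) (x : M) (j : Fin p → Fin 4)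
    (S : Fin 4 → Fin 4 → ℝ) (hS : ∀ r s, S s r = -S r s)
    (hS' : ∀ r s, (q.factorial : ℝ)⁻¹ * ∑ i : Fin q → Fin 4,
      eps h2 (fun l => Fin.append ![r, s] i (Fin.cast h1.symm l)) j * eps h a i *
        etaProd i * etaProd j = S r s) :
    ϑ.star h2 (fwedge h1 (extD (ϑ.down m)) (ϑ.star h (ϑ.basis a))) x (fun l => ϑ.frame x (j l)) =
      ∑ r, ∑ s, S r s * ϑ.jet x m r s := by
  refine ((ϑ.isDual x).hodge_wedge_hodge_apply h h1 h2 (extD (ϑ.down m) x) a j).trans ?_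
  simp_rw [extD_down_apply]
  have h3 : ∑ r, ∑ s, S r s * ϑ.jet x m s r = -∑ r, ∑ s, S r s * ϑ.jet x m r s := by
    rw [Finset.sum_comm, ← Finset.sum_neg_distrib]
    refine Finset.sum_congr rfl fun r _ => ?_
    rw [← Finset.sum_neg_distrib]
    exact Finset.sum_congr rfl fun s _ => by rw [hS]; ring
  have h4 : ∑ r, ∑ s, S r s * ϑ.jet x m r s =
      2⁻¹ * ∑ r, ∑ s, S r s * (ϑ.jet x m r s - ϑ.jet x m s r) := by
    simp_rw [mul_sub, Finset.sum_sub_distrib]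
    rw [h3]
    ring
  rw [h4, ← (finTwoArrowEquiv (Fin 4)).symm.sum_comp, Fintype.sum_prod_type]
  simp_rw [← hS', Finset.mul_sum, Finset.sum_mul]
  refine Finset.sum_congr rfl fun r _ => Finset.sum_congr rfl fun s _ => ?_
  rw [Finset.mul_sum]
  refine Finset.sum_congr rfl fun i _ => ?_
  simp only [finTwoArrowEquiv_symm_apply, Matrix.cons_val_zero, Matrix.cons_val_one]
  rw [mul_inv]
  ring

/-- A basis form of degree `n` leaves `4 - n` contracted indices, so degrees 2, 3, 4 call for the
three contraction identities in turn. -/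
theorem star_wedge_star_basis_two (m a b : Fin 4) :
    ϑ.star (p := 4) (q := 0) rfl (fwedge (m := 2) (n := 2) rfl (extD (ϑ.down m))
      (ϑ.star (p := 2) (q := 2) rfl (ϑ.basis ![a, b]))) =
      -fsmul (ϑ.anholMixed m a b) (ϑ.basis ![]) := by
  refine ϑ.ext fun x j => ?_
  rw [ϑ.star_wedge_star_basis_apply _ _ _ m _ x j (fun r s => -etaInt₂ r s a b)]
  · simp only [neg_mul, Finset.sum_neg_distrib, sum_etaInt₂_mul_jet]
    simp [fsmul, basis, wedgeProd, zeroForm]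
  · intro r s
    rw [etaInt₂_swap]
    push_cast
    ring
  · intro r s
    have h1 : ∀ i : Fin 2 → Fin 4, eps (rfl : 2 + 2 = 4) ![a, b] i =
      epsInt a b (i 0) (i 1) := fun i => epsilon_eq _
    have h2 : ∀ i : Fin 2 → Fin 4, eps (rfl : 4 + 0 = 4)
      (fun l => Fin.append ![r, s] i (Fin.cast rfl l)) j = epsInt r s (i 0) (i 1) :=
      fun i => epsilon_eq _
    have := congrArg (Int.cast (R := ℝ)) (epsInt_contract_two r s a b)
    push_cast at this
    simp_rw [h1, h2, sum_fin_succ, Fintype.sum_unique, etaProd, Fin.prod_univ_two, eta_eq]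
    simp
    rw [inv_mul_eq_iff_eq_mul₀ two_ne_zero, mul_neg, ← neg_mul, ← this]
    refine Finset.sum_congr rfl fun i _ => Finset.sum_congr rfl fun k _ => ?_
    ring

theorem star_wedge_star_basis_three (m a b c : Fin 4) :
    ϑ.star (p := 3) (q := 1) rfl (fwedge (m := 2) (n := 1) rfl (extD (ϑ.down m))
      (ϑ.star (p := 3) (q := 1) rfl (ϑ.basis ![a, b, c]))) =
      fsmul (ϑ.anholMixed m a b) (ϑ.up c) - fsmul (ϑ.anholMixed m a c) (ϑ.up b) +
        fsmul (ϑ.anholMixed m b c) (ϑ.up a) := by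
  refine ϑ.ext fun x j => ?_
  rw [ϑ.star_wedge_star_basis_apply _ _ _ m _ x j (fun r s => etaInt₂ r s a b * delta c (j 0) -
    etaInt₂ r s a c * delta b (j 0) + etaInt₂ r s b c * delta a (j 0))]
  · simp only [fsmul, Pi.sub_apply, Pi.add_apply,
      ContinuousAlternatingMap.sub_apply, ContinuousAlternatingMap.add_apply,
      ContinuousAlternatingMap.smul_apply, smul_eq_mul,
      basis_one_apply, ← sum_etaInt₂_mul_jet, Finset.sum_mul,
      ← Finset.sum_sub_distrib, ← Finset.sum_add_distrib]
    exact Finset.sum_congr rfl fun r _ => Finset.sum_congr rfl fun s _ => by ring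
  · intro r s
    simp only [etaInt₂_swap r s]
    push_cast
    ring
  · intro r s
    have h1 : ∀ i : Fin 1 → Fin 4, eps (rfl : 3 + 1 = 4) ![a, b, c] i =
      epsInt a b c (i 0) := fun i => epsilon_eq _
    have h2 : ∀ i : Fin 1 → Fin 4, eps (rfl : 3 + 1 = 4)
      (fun l => Fin.append ![r, s] i (Fin.cast rfl l)) j = epsInt r s (i 0) (j 0) :=
      fun i => epsilon_eq _
    have := congrArg (Int.cast (R := ℝ)) (epsInt_contract_one r s a b c (j 0))
    push_cast at this
    simp_rw [h1, h2, sum_fin_succ, Fintype.sum_unique, etaProd, Fin.prod_univ_one, eta_eq]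
    simp
    rw [← this]
    exact Finset.sum_congr rfl fun i _ => by ring

theorem star_wedge_star_basis_four (m a b c d : Fin 4) :
    ϑ.star (p := 2) (q := 2) rfl (fwedge (m := 2) (n := 0) rfl (extD (ϑ.down m))
      (ϑ.star (p := 4) (q := 0) rfl (ϑ.basis ![a, b, c, d]))) =
      -(fsmul (ϑ.anholMixed m a b) (ϑ.basis ![c, d]) - fsmul (ϑ.anholMixed m a c) (ϑ.basis ![b, d])
      + fsmul (ϑ.anholMixed m a d) (ϑ.basis ![b, c]) + fsmul (ϑ.anholMixed m b c) (ϑ.basis ![a, d])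
      - fsmul (ϑ.anholMixed m b d) (ϑ.basis ![a, c])
      + fsmul (ϑ.anholMixed m c d) (ϑ.basis ![a, b])) := by
  refine ϑ.ext fun x j => ?_
  rw [ϑ.star_wedge_star_basis_apply _ _ _ m _ x j (fun r s =>
    -(etaInt₂ r s a b * delta₂ c d (j 0) (j 1) - etaInt₂ r s a c * delta₂ b d (j 0) (j 1) +
        etaInt₂ r s a d * delta₂ b c (j 0) (j 1) + etaInt₂ r s b c * delta₂ a d (j 0) (j 1) -
        etaInt₂ r s b d * delta₂ a c (j 0) (j 1) + etaInt₂ r s c d * delta₂ a b (j 0) (j 1)))]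
  · simp only [fsmul, Pi.sub_apply, Pi.add_apply, Pi.neg_apply, ContinuousAlternatingMap.neg_apply,
      ContinuousAlternatingMap.sub_apply, ContinuousAlternatingMap.add_apply,
      ContinuousAlternatingMap.smul_apply, smul_eq_mul,
      basis_two_apply, ← sum_etaInt₂_mul_jet, Finset.sum_mul,
      ← Finset.sum_sub_distrib, ← Finset.sum_add_distrib, ← Finset.sum_neg_distrib]
    exact Finset.sum_congr rfl fun r _ => Finset.sum_congr rfl fun s _ => by ring
  · intro r s
    simp only [etaInt₂_swap r s]
    push_cast
    ring
  · intro r s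
    have h1 : ∀ i : Fin 0 → Fin 4, eps (rfl : 4 + 0 = 4) ![a, b, c, d] i =
      epsInt a b c d := fun i => epsilon_eq _
    have h2 : ∀ i : Fin 0 → Fin 4, eps (rfl : 2 + 2 = 4)
      (fun l => Fin.append ![r, s] i (Fin.cast rfl l)) j = epsInt r s (j 0) (j 1) :=
      fun i => epsilon_eq _
    have := congrArg (Int.cast (R := ℝ)) (epsInt_contract_zero r s (j 0) (j 1) a b c d)
    push_cast at this
    simp_rw [h1, h2, Fintype.sum_unique, etaProd, Fin.prod_univ_two, Fin.prod_univ_zero, eta_eq]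
    rw [← this]
    simp
    ring

/-- True by definition of `wedgeProd`; products in the recursion thereby become questions of index
order. -/
theorem wedgeLeft_basis {k : ℕ} (x : M) (a : Fin 4) (b : Fin k → Fin 4) :
    wedgeLeft (Nat.add_comm 1 k) (ϑ.up a x) (ϑ.basis b x) =
      ϑ.basis (Matrix.vecCons a b) x := rfl

theorem basis_comp_perm {p : ℕ} (x : M) (a : Fin p → Fin 4) (σ : Equiv.Perm (Fin p)) :
    ϑ.basis (a ∘ σ) x = ((Equiv.Perm.sign σ : ℤ) : ℝ) • ϑ.basis a x := by
  ext v
  rw [ContinuousAlternatingMap.smul_apply, basis, basis, wedgeProd_apply', wedgeProd_apply',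
    smul_eq_mul, Finset.mul_sum]
  refine Fintype.sum_equiv (Equiv.mulLeft σ) _ _ fun τ => ?_
  simp only [Equiv.coe_mulLeft, Equiv.Perm.sign_mul, Units.val_mul, Int.cast_mul, ← mul_assoc,
    sign_mul_self_cast, one_mul]
  rfl

theorem basis_swap {k : ℕ} (x : M) (a b : Fin 4) (c : Fin k → Fin 4) :
    ϑ.basis (Matrix.vecCons b (Matrix.vecCons a c)) x =
      -ϑ.basis (Matrix.vecCons a (Matrix.vecCons b c)) x := by
  have h : (Matrix.vecCons b (Matrix.vecCons a c) : Fin (k + 2) → Fin 4) =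
      Matrix.vecCons a (Matrix.vecCons b c) ∘ Equiv.swap 0 1 := by
    funext i
    refine Fin.cases ?_ (fun i => Fin.cases ?_ (fun i => ?_) i) i
    · simp
    · simp
    · rw [Function.comp_apply, Equiv.swap_apply_of_ne_of_ne] <;> simp [Fin.ext_iff]
  rw [h, basis_comp_perm, Equiv.Perm.sign_swap (by simp)]
  simp only [Units.val_neg, Units.val_one, Int.cast_neg, Int.cast_one]
  ext v
  rw [ContinuousAlternatingMap.smul_apply, ContinuousAlternatingMap.neg_apply, smul_eq_mul,
    neg_one_mul]

theorem basis_swap' {k : ℕ} (x : M) (a b c : Fin 4) (d : Fin k → Fin 4) :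
    ϑ.basis (Matrix.vecCons a (Matrix.vecCons c (Matrix.vecCons b d))) x =
      -ϑ.basis (Matrix.vecCons a (Matrix.vecCons b (Matrix.vecCons c d))) x := by
  rw [← wedgeLeft_basis, basis_swap, map_neg, wedgeLeft_basis]

theorem anholMixed_swap (m a b : Fin 4) (x : M) :
    ϑ.anholMixed m b a x = -ϑ.anholMixed m a b x := by
  rw [anholMixed_eq, anholMixed_eq]
  ring

theorem recursion_two {q r : ℕ} (hq : 2 + q = 4) (hr : r + 0 = 4)
    (hqr : 2 + q = r) (h₁ : 1 + 1 ≤ 4) (h₂ : 0 + 1 ≤ 4) (a : Fin 2 → Fin 4) :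
    (((0 : ℕ) : ℝ) + 1) • ϑ.codiff (p := 1) h₁ (ϑ.basis a) =
      ∑ i : Fin 2, (-1 : ℝ) ^ ((i : ℕ) + 1) • fwedge (Nat.add_comm 1 0) (ϑ.up (a i))
        (ϑ.codiff (p := 0) h₂ (ϑ.basis (fun j => a (i.succAbove j)))) +
      (-1 : ℝ) ^ (0 + 2) • ∑ m : Fin 4, fwedge (Nat.add_comm 1 0) (ϑ.up m)
        (ϑ.star (p := r) (q := 0) hr (fwedge (m := 2) (n := q) hqr (extD (ϑ.down m))
          (ϑ.star (p := 2) (q := q) hq (ϑ.basis a)))) := by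
  obtain rfl : q = 2 := by omega
  obtain rfl : r = 4 := by omega
  obtain ⟨a, b, rfl⟩ : ∃ b c, a = ![b, c] := ⟨a 0, a 1, by funext i; fin_cases i <;> rfl⟩
  have h0 : (fun j : Fin 1 => ![a, b] (Fin.succAbove 0 j)) = ![b] := by
    funext i; fin_cases i; rfl
  have h1 : (fun j : Fin 1 => ![a, b] (Fin.succAbove 1 j)) = ![a] := by
    funext i; fin_cases i; rfl
  -- Functions are written as multiples of the empty product so that `wedgeLeft_basis` covers degree
  -- 0.
  have hz : ∀ f : M → ℝ, ofFun f = fsmul f (ϑ.basis ![]) := by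
    intro f
    funext x
    ext v
    simp [ofFun, fsmul, basis, wedgeProd, zeroForm]
  rw [Fin.sum_univ_two]
  simp only [h0, h1, star_wedge_star_basis_two, basis_one, codiff_up, codiff_basis_two, hz,
    Matrix.cons_val_zero, Matrix.cons_val_one]
  funext x
  simp only [Pi.smul_apply, Pi.add_apply, Pi.sub_apply, Pi.neg_apply, Finset.sum_apply,
    fwedge_apply, fsmul, map_smul, map_neg, wedgeLeft_basis, basis_one, Finset.sum_neg_distrib]
  norm_num
  module

theorem recursion_three {q r : ℕ} (hq : 3 + q = 4) (hr : r + 1 = 4)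
    (hqr : 2 + q = r) (h₁ : 2 + 1 ≤ 4) (h₂ : 1 + 1 ≤ 4) (a : Fin 3 → Fin 4) :
    (((1 : ℕ) : ℝ) + 1) • ϑ.codiff (p := 2) h₁ (ϑ.basis a) =
      ∑ i : Fin 3, (-1 : ℝ) ^ ((i : ℕ) + 1) • fwedge (Nat.add_comm 1 1) (ϑ.up (a i))
        (ϑ.codiff (p := 1) h₂ (ϑ.basis (fun j => a (i.succAbove j)))) +
      (-1 : ℝ) ^ (1 + 2) • ∑ m : Fin 4, fwedge (Nat.add_comm 1 1) (ϑ.up m)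
        (ϑ.star (p := r) (q := 1) hr (fwedge (m := 2) (n := q) hqr (extD (ϑ.down m))
          (ϑ.star (p := 3) (q := q) hq (ϑ.basis a)))) := by
  obtain rfl : q = 1 := by omega
  obtain rfl : r = 3 := by omega
  obtain ⟨a, b, c, rfl⟩ : ∃ b c d, a = ![b, c, d] :=
    ⟨a 0, a 1, a 2, by funext i; fin_cases i <;> rfl⟩
  have h0 : (fun j : Fin 2 => ![a, b, c] (Fin.succAbove 0 j)) = ![b, c] := by
    funext i; fin_cases i <;> rfl
  have h1 : (fun j : Fin 2 => ![a, b, c] (Fin.succAbove 1 j)) = ![a, c] := by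
    funext i; fin_cases i <;> rfl
  have h2 : (fun j : Fin 2 => ![a, b, c] (Fin.succAbove 2 j)) = ![a, b] := by
    funext i; fin_cases i <;> rfl
  rw [Fin.sum_univ_three]
  simp only [h0, h1, h2, star_wedge_star_basis_three, codiff_basis_two, codiff_basis_three,
    Matrix.cons_val_zero, Matrix.cons_val_one, Matrix.cons_val]
  funext x
  -- The summation index is moved to the last slot so that equal sums become identical atoms for
  -- `module`.
  have hs : ∀ (f : Fin 4 → ℝ) (d : Fin 4), ∑ m, f m • ϑ.basis ![m, d] x =
      -∑ m, f m • ϑ.basis ![d, m] x := by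
    intro f d
    rw [← Finset.sum_neg_distrib]
    exact Finset.sum_congr rfl fun m _ => by rw [basis_swap, smul_neg]
  have hw : ∀ d e : Fin 4, wedgeLeft (Nat.add_comm 1 1) (ϑ.up d x) (ϑ.up e x) =
      ϑ.basis ![d, e] x := fun d e => by rw [← ϑ.basis_one e, wedgeLeft_basis]
  simp only [Pi.smul_apply, Pi.add_apply, Pi.sub_apply, Finset.sum_apply,
    fwedge_apply, fsmul, map_smul, map_add, map_sub, map_sum, Finset.sum_add_distrib,
    Finset.sum_sub_distrib]
  simp only [hw, hs, ϑ.basis_swap x b c, ϑ.basis_swap x a c, ϑ.basis_swap x a b]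
  norm_num
  module

theorem recursion_four {q r : ℕ} (hq : 4 + q = 4) (hr : r + 2 = 4)
    (hqr : 2 + q = r) (h₁ : 3 + 1 ≤ 4) (h₂ : 2 + 1 ≤ 4) (a : Fin 4 → Fin 4) :
    (((2 : ℕ) : ℝ) + 1) • ϑ.codiff (p := 3) h₁ (ϑ.basis a) =
      ∑ i : Fin 4, (-1 : ℝ) ^ ((i : ℕ) + 1) • fwedge (Nat.add_comm 1 2) (ϑ.up (a i))
        (ϑ.codiff (p := 2) h₂ (ϑ.basis (fun j => a (i.succAbove j)))) +
      (-1 : ℝ) ^ (2 + 2) • ∑ m : Fin 4, fwedge (Nat.add_comm 1 2) (ϑ.up m)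
        (ϑ.star (p := r) (q := 2) hr (fwedge (m := 2) (n := q) hqr (extD (ϑ.down m))
          (ϑ.star (p := 4) (q := q) hq (ϑ.basis a)))) := by
  obtain rfl : q = 0 := by omega
  obtain rfl : r = 2 := by omega
  rw [codiff_basis_four]
  obtain ⟨a, b, c, d, rfl⟩ : ∃ b c d e, a = ![b, c, d, e] :=
    ⟨a 0, a 1, a 2, a 3, by funext i; fin_cases i <;> rfl⟩
  have h0 : (fun j : Fin 3 => ![a, b, c, d] (Fin.succAbove 0 j)) = ![b, c, d] := by
    funext i; fin_cases i <;> rfl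
  have h1 : (fun j : Fin 3 => ![a, b, c, d] (Fin.succAbove 1 j)) = ![a, c, d] := by
    funext i; fin_cases i <;> rfl
  have h2 : (fun j : Fin 3 => ![a, b, c, d] (Fin.succAbove 2 j)) = ![a, b, d] := by
    funext i; fin_cases i <;> rfl
  have h3 : (fun j : Fin 3 => ![a, b, c, d] (Fin.succAbove 3 j)) = ![a, b, c] := by
    funext i; fin_cases i <;> rfl
  rw [Fin.sum_univ_four]
  simp only [h0, h1, h2, h3, star_wedge_star_basis_four, codiff_basis_three,
    Matrix.cons_val_zero, Matrix.cons_val_one, Matrix.cons_val]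
  funext x
  -- The fifth index is set equal to the lower index `m` of `C_m^{cd}` and summed; terms with `m` in
  -- the upper pair become traces.
  have hQ : ∑ m, antisymmSum (fun c d => ϑ.anholMixed m c d x) (fun c d e => ϑ.basis ![c, d, e] x)
      a b c d m = 0 := Finset.sum_eq_zero fun m _ =>
    antisymmSum_eq_zero (β := fun c d => ϑ.anholMixed m c d x)
      (w := fun c d e => ϑ.basis ![c, d, e] x) (fun a b => ϑ.anholMixed_swap m a b x)
      (fun a b c => ϑ.basis_swap x a b ![c]) (fun a b c => ϑ.basis_swap' x a b c ![]) a b c d m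
  simp only [antisymmSum, Finset.sum_add_distrib, Finset.sum_sub_distrib, ← Finset.sum_smul,
    ← anholTraceUp_eq] at hQ
  have hs : ∀ (f : Fin 4 → ℝ) (d e : Fin 4), ∑ m, f m • ϑ.basis ![m, d, e] x =
      ∑ m, f m • ϑ.basis ![d, e, m] x := by
    intro f d e
    exact Finset.sum_congr rfl fun m _ => by rw [basis_swap, basis_swap', neg_neg]
  simp only [Pi.smul_apply, Pi.add_apply, Pi.sub_apply, Pi.neg_apply, Pi.zero_apply,
    smul_zero, Finset.sum_apply, Finset.sum_neg_distrib, fwedge_apply, fsmul, map_smul, map_add,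
    map_sub, map_neg, map_sum,
    Finset.sum_add_distrib, Finset.sum_sub_distrib]
  simp only [wedgeLeft_basis, hs, ϑ.basis_swap x a b, ϑ.basis_swap x a c, ϑ.basis_swap x a d,
    ϑ.basis_swap x b c, ϑ.basis_swap x b d, ϑ.basis_swap x c d, ϑ.basis_swap' x a b c,
    ϑ.basis_swap' x a b d, ϑ.basis_swap' x a c d, ϑ.basis_swap' x b c d, smul_neg,
    Finset.sum_neg_distrib]
  norm_num
  generalize ∑ m, ϑ.anholMixed m a b x • ϑ.basis ![c, d, m] x = s0 at hQ ⊢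
  generalize ∑ m, ϑ.anholMixed m a c x • ϑ.basis ![b, d, m] x = s1 at hQ ⊢
  generalize ∑ m, ϑ.anholMixed m a d x • ϑ.basis ![b, c, m] x = s2 at hQ ⊢
  generalize ∑ m, ϑ.anholMixed m b c x • ϑ.basis ![a, d, m] x = s3 at hQ ⊢
  generalize ∑ m, ϑ.anholMixed m b d x • ϑ.basis ![a, c, m] x = s4 at hQ ⊢
  generalize ∑ m, ϑ.anholMixed m c d x • ϑ.basis ![a, b, m] x = s5 at hQ ⊢
  generalize ϑ.basis ![a, b, c] x = w0 at hQ ⊢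
  generalize ϑ.basis ![a, b, d] x = w1 at hQ ⊢
  generalize ϑ.basis ![a, c, d] x = w2 at hQ ⊢
  generalize ϑ.basis ![b, c, d] x = w3 at hQ ⊢
  generalize ϑ.anholTraceUp a x = c0 at hQ ⊢
  generalize ϑ.anholTraceUp b x = c1 at hQ ⊢
  generalize ϑ.anholTraceUp c x = c2 at hQ ⊢
  generalize ϑ.anholTraceUp d x = c3 at hQ ⊢
  -- Why 3: `C^a ϑ^{bcd}` arises from the three triples containing `a`; `C_m^{ab} ϑ^{cdm}` arises
  -- from the two triples containing `a, b` and once from `*(dϑ_m ∧ *ϑ^{abcd})`.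
  linear_combination (norm := module) (3 : ℝ) • hQ

end Coframe
end Manifold

end CoframeGeometry

end

theorem proposition4p1 {M : Type*} [TopologicalSpace M]
    [ChartedSpace (EuclideanSpace ℝ (Fin 4)) M] [IsManifold (𝓡 4) ∞ M] (ϑ : Coframe M) :
    -- the recursion, for a basis form of degree `p = k + 2`, `2 ≤ p ≤ 4`
    (∀ (k : ℕ) (hk : k + 2 ≤ 4) (a : Fin (k + 2) → Fin 4),
      ((k : ℝ) + 1) • ϑ.codiff (p := k + 1) (by omega) (ϑ.basis a) =
        ∑ i : Fin (k + 2), (-1 : ℝ) ^ ((i : ℕ) + 1) •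
          fwedge (Nat.add_comm 1 k) (ϑ.up (a i))
            (ϑ.codiff (p := k) (by omega) (ϑ.basis (fun j => a (i.succAbove j)))) +
        (-1 : ℝ) ^ (k + 2) • ∑ m : Fin 4,
          fwedge (Nat.add_comm 1 k) (ϑ.up m)
            (ϑ.star (p := 4 - k) (q := k) (by omega)
              (fwedge (m := 2) (n := 4 - (k + 2)) (r := 4 - k) (by omega)
                (extD (ϑ.down m))
                (ϑ.star (p := k + 2) (q := 4 - (k + 2)) (by omega) (ϑ.basis a))))) ∧
    (∀ a : Fin 4, ϑ.codiff (p := 0) (by omega) (ϑ.up a) = ofFun (ϑ.anholTraceUp a)) ∧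
    (∀ a b : Fin 4, ϑ.codiff (p := 1) (by omega) (ϑ.basis ![a, b]) =
      fsmul (ϑ.anholTraceUp a) (ϑ.up b) - fsmul (ϑ.anholTraceUp b) (ϑ.up a) -
        ∑ m : Fin 4, fsmul (ϑ.anholMixed m a b) (ϑ.up m)) ∧
    (∀ a b c : Fin 4, ϑ.codiff (p := 2) (by omega) (ϑ.basis ![a, b, c]) =
      fsmul (ϑ.anholTraceUp a) (ϑ.basis ![b, c]) - fsmul (ϑ.anholTraceUp b) (ϑ.basis ![a, c]) +
        fsmul (ϑ.anholTraceUp c) (ϑ.basis ![a, b]) +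
        ∑ m : Fin 4, fsmul (ϑ.anholMixed m b c) (ϑ.basis ![a, m]) -
        ∑ m : Fin 4, fsmul (ϑ.anholMixed m a c) (ϑ.basis ![b, m]) +
        ∑ m : Fin 4, fsmul (ϑ.anholMixed m a b) (ϑ.basis ![c, m])) ∧
    (∀ a b c e : Fin 4, ϑ.codiff (p := 3) (by omega) (ϑ.basis ![a, b, c, e]) = 0) := by
  refine ⟨fun k hk a => ?_, ϑ.codiff_up _, ϑ.codiff_basis_two _, ϑ.codiff_basis_three _,
    fun a b c e => ϑ.codiff_basis_four _ _⟩
  -- Passing to real values lets the degree expressions here, such as `0 + 1`, match those of the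
  -- recursion lemmas by computation.
  rw [smul_eq_sum_smul_add_smul_sum_iff]
  intro x v
  obtain rfl | rfl | rfl : k = 0 ∨ k = 1 ∨ k = 2 := by omega
  · exact (smul_eq_sum_smul_add_smul_sum_iff _ _ _ _ _ _).1 (ϑ.recursion_two _ _ _ _ _ a) x v
  · exact (smul_eq_sum_smul_add_smul_sum_iff _ _ _ _ _ _).1 (ϑ.recursion_three _ _ _ _ _ a) x v
  · exact (smul_eq_sum_smul_add_smul_sum_iff _ _ _ _ _ _).1 (ϑ.recursion_four _ _ _ _ _ a) x v
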